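/- Let $\mathbb H=\{(z_1,z_2)\in\mathbb C^2:|z_1|<|z_2|<1\}$ be the Hartogs triangle, let $dV$ be Lebesgue measure and $|U|$ the Lebesgue measure of $U$. For $a\in\mathbb R$ let $L^{4/3}(\mathbb H,|z_2|^{a})$ be the $L^{4/3}$ space of the measure $|z_2|^{a}\,dV$ on $\mathbb H$. Let $P$ be the Bergman projection of $\mathbb H$, that is, the orthogonal projection of $L^2(\mathbb H)$ onto its subspace $A^2(\mathbb H)$ of square-integrable holomorphic functions; it is given by the Bergman kernel $K_{\mathbb H}$ of $\mathbb H$ (so $K_{\mathbb H}$ exists), $$P(f)(z)=\int_{\mathbb H}K_{\mathbb H}(z;\bar w)f(w)\,dV(w),\qquad z\in\mathbb H,$$ and this integral defines $P(f)$ for every $f$ for which it converges absolutely. (1) For every $\varepsilon>0$, $P$ is defined on $L^{4/3}(\mathbb H,|z_2|^{-\varepsilon})$ and maps it boundedly to weak $L^{4/3}(\mathbb H)$: there is a constant $C=C(\varepsilon)<\infty$ such that for every $f\in L^{4/3}(\mathbb H,|z_2|^{-\varepsilon})$ the integral above converges absolutely for every $z\in\mathbb H$, the function $P(f)$ is measurable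 on $\mathbb H$, and for every $\lambda>0$ $$\bigl|\{z\in\mathbb H:|P(f)(z)|>\lambda\}\bigr|\le C\,\frac{\|f\|^{4/3}_{L^{4/3}(\mathbb H,|z_2|^{-\varepsilon})}}{\lambda^{4/3}}.$$ (2) For $0<\varepsilon<\tfrac83$, $P$ is bounded on $L^{4/3}(\mathbb H,|z_2|^{-\varepsilon})$: there is $C=C(\varepsilon)<\infty$ such that $P(f)\in L^{4/3}(\mathbb H,|z_2|^{-\varepsilon})$ and $\|P(f)\|_{L^{4/3}(\mathbb H,|z_2|^{-\varepsilon})}\le C\|f\|_{L^{4/3}(\mathbb H,|z_2|^{-\varepsilon})}$ for every $f\in L^{4/3}(\mathbb H,|z_2|^{-\varepsilon})$. -/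

import Mathlib

open MeasureTheory
open scoped ENNReal NNReal ComplexConjugate

/-- The Hartogs triangle `{(z₁, z₂) ∈ ℂ² : |z₁| < |z₂| < 1}`. -/
def hartogsTriangle : Set (ℂ × ℂ) := {z | ‖z.1‖ < ‖z.2‖ ∧ ‖z.2‖ < 1}

/-- The Bergman space `A²(Ω)` of an open set `Ω`: the classes in `L²(Ω)` (Lebesgue measure) that have
a representative which is holomorphic on `Ω`. -/
def bergmanSpace (Ω : Set (ℂ × ℂ)) : Submodule ℂ (Lp ℂ 2 (volume.restrict Ω)) where
  carrier := {f | ∃ g : ℂ × ℂ → ℂ, DifferentiableOn ℂ g Ω ∧ f =ᵐ[volume.restrict Ω] g}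
  zero_mem' := ⟨fun _ => 0, differentiableOn_const _, Lp.coeFn_zero _ _ _⟩
  add_mem' := by
    rintro a b ⟨g, hg, hag⟩ ⟨h, hh, hbh⟩
    exact ⟨g + h, hg.add hh, (Lp.coeFn_add a b).trans (hag.add hbh)⟩
  smul_mem' := by
    rintro c a ⟨g, hg, hag⟩
    exact ⟨c • g, hg.const_smul c, (Lp.coeFn_smul c a).trans (hag.const_smul c)⟩

/-- The integral operator `f ↦ ∫_Ω K(z, w) f(w) dV(w)`. -/
noncomputable def kernelOperator (Ω : Set (ℂ × ℂ)) (K : ℂ × ℂ → ℂ × ℂ → ℂ)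
    (f : ℂ × ℂ → ℂ) (z : ℂ × ℂ) : ℂ :=
  ∫ w in Ω, K z w * f w

/-- `K` is the Bergman kernel of the open set `Ω`: for `z ∈ Ω` the function `K(z, ·)` is
square-integrable and antiholomorphic on `Ω`, and integration against `K` is the orthogonal
projection of `L²(Ω)` onto `A²(Ω)`, i.e. for `f ∈ L²(Ω)` the function `∫_Ω K(·, w) f(w) dV(w)` is
square-integrable and holomorphic on `Ω`, and its difference from `f` is orthogonal to `A²(Ω)`.
These properties determine `K` on `Ω × Ω`. -/
structure IsBergmanKernel (Ω : Set (ℂ × ℂ)) (K : ℂ × ℂ → ℂ × ℂ → ℂ) : Prop where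
  memLp : ∀ z ∈ Ω, MemLp (K z) 2 (volume.restrict Ω)
  antiholomorphic : ∀ z ∈ Ω, DifferentiableOn ℂ (fun w => conj (K z w)) Ω
  holomorphic : ∀ f : Lp ℂ 2 (volume.restrict Ω), DifferentiableOn ℂ (kernelOperator Ω K f) Ω
  projection : ∀ f : Lp ℂ 2 (volume.restrict Ω),
    ∃ h : MemLp (kernelOperator Ω K f) 2 (volume.restrict Ω), f - h.toLp ∈ (bergmanSpace Ω)ᗮ

open Classical in
/-- The Bergman kernel of `Ω` (the value `0` is a dummy, for sets without a Bergman kernel). -/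
noncomputable def bergmanKernel (Ω : Set (ℂ × ℂ)) : ℂ × ℂ → ℂ × ℂ → ℂ :=
  if h : ∃ K, IsBergmanKernel Ω K then h.choose else fun _ _ => 0

/-- The Bergman projection of `Ω`, as an integral operator on all functions for which the integral
converges: `P f (z) = ∫_Ω K_Ω(z, w) f(w) dV(w)`. -/
noncomputable def bergmanProjection (Ω : Set (ℂ × ℂ)) (f : ℂ × ℂ → ℂ) : ℂ × ℂ → ℂ :=
  kernelOperator Ω (bergmanKernel Ω) f

/-- The measure `|z₂|^a dV` on the Hartogs triangle. -/
noncomputable def hartogsMeasure (a : ℝ) : Measure (ℂ × ℂ) :=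
  (volume.restrict hartogsTriangle).withDensity fun z => ENNReal.ofReal (‖z.2‖ ^ a)

/-! The map `(u, v) ↦ (u v, v)` carries the disc times the punctured disc onto the Hartogs triangle,
with real Jacobian `|v|²`. Hence `g ↦ v g(u v, v)` is an isometry from `A²` of the triangle into
`L²` of the bidisc. The slices of its image are square-integrable and holomorphic off `0`, so the
singularity at `0` is removable and the Bergman kernel of the disc reproduces them. This gives the
explicit kernel `hartogsKernel`: the product of two disc kernels, in `z₁/z₂` and in `z₂`, divided by
`z₂ conj w₂`.

For the norm bound, the kernel is replaced by its absolute value. On the bidisc this gives a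
positive operator with kernel at most `|B(x₁, y₁)| |B(x₂, y₂)| |y₂| / |x₂|`, where `B` is
`diskKernel`. Schur's test (`lintegral_rpow_le_of_schur`) is applied with powers of `1 - |·|²` and
of `|·₂|`; the two integrals to check are Forelli-Rudin integrals (`lintegral_diskKernel_le`), in
which an extra factor `|t|^d` is harmless as long as `d > -2`. This proves boundedness on
`L^p(|z₂|^{-ε})` for `1 < p < 3` and `4 - 3p < ε < 4 - p`. For `p = 4/3` the range is `0 < ε < 8/3`,
which is (2). Since `|z₂|^{-ε} ≥ 1` on the triangle, (1) follows from the strong bound and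
Chebyshev's inequality.

It remains to show that `hartogsKernel` is the Bergman kernel. The case `p = 2`, `ε = 0` of the
bound gives an operator on `L²` and justifies Fubini. Differentiation under the integral makes its
values holomorphic, and the reproducing property with Hermitian symmetry makes it the orthogonal
projection. As `bergmanKernel` is chosen among all Bergman kernels, uniqueness up to null sets
(`IsBergmanKernel.ae_eq`) transfers the results to it. -/

/-! ### Polar coordinates on a disc. -/

theorem Real.intervalIntegral_circleMap_eq_circleAverage {E : Type*} [NormedAddCommGroup E]
    [NormedSpace ℝ E] (f : ℂ → E) (c : ℂ) (r : ℝ) :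
    ∫ θ in (-Real.pi)..Real.pi, f (circleMap c r θ) = (2 * Real.pi) • Real.circleAverage f c r := by
  have t₀ : (fun θ ↦ f (circleMap c r θ)).Periodic (2 * Real.pi) :=
    fun x ↦ by simp [periodic_circleMap c r x]
  have h := t₀.intervalIntegral_add_eq (-Real.pi) 0
  rw [show -Real.pi + 2 * Real.pi = Real.pi by ring, zero_add] at h
  rw [h, Real.circleAverage_def, smul_smul, mul_inv_cancel₀ (by positivity), one_smul]

theorem Complex.polarCoord_symm_eq_circleMap (p : ℝ × ℝ) :
    Complex.polarCoord.symm p = circleMap 0 p.1 p.2 := by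
  rw [Complex.polarCoord_symm_apply, circleMap_zero, Complex.exp_mul_I]
  simp

theorem lintegral_ball_eq_lintegral_circleMap {f : ℂ → ℝ≥0∞} (hf : Measurable f) (R : ℝ) :
    ∫⁻ t in Metric.ball (0 : ℂ) R, f t = ∫⁻ r in Set.Ioo 0 R,
      ENNReal.ofReal r * ∫⁻ θ in Set.Ioo (-Real.pi) Real.pi, f (circleMap 0 r θ) := by
  have hc : Measurable fun p : ℝ × ℝ => circleMap 0 p.1 p.2 := by
    unfold circleMap; fun_prop
  have hm : Measurable (Set.indicator (Metric.ball (0 : ℂ) R) f) := hf.indicator measurableSet_ball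
  rw [← lintegral_indicator measurableSet_ball, ← Complex.lintegral_comp_polarCoord_symm,
    polarCoord_target, Measure.volume_eq_prod, ← Measure.prod_restrict, lintegral_prod]
  · rw [← lintegral_indicator measurableSet_Ioi, ← lintegral_indicator measurableSet_Ioo]
    refine lintegral_congr fun r => ?_
    have key : ∀ θ, (Metric.ball (0 : ℂ) R).indicator f (circleMap 0 r θ) =
        if |r| < R then f (circleMap 0 r θ) else 0 := fun θ => by
      classical
      rw [Set.indicator_apply]
      simp
    simp only [Set.indicator_apply (Set.Ioi _), Set.indicator_apply (Set.Ioo _ _), Set.mem_Ioi,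
      Set.mem_Ioo, Complex.polarCoord_symm_eq_circleMap, key]
    by_cases h0 : 0 < r
    · by_cases h1 : r < R
      · simp only [h0, h1, abs_of_pos h0, smul_eq_mul, if_true, and_self]
        rw [lintegral_const_mul]
        exact hf.comp (hc.comp (by fun_prop : Measurable fun θ : ℝ => (r, θ)))
      · simp [h0, h1, abs_of_pos h0]
    · simp [h0]
  · simp only [Complex.polarCoord_symm_eq_circleMap]
    exact (measurable_fst.ennreal_ofReal.smul (hm.comp hc)).aemeasurable

theorem integral_ball_eq_integral_circleAverage {f : ℂ → ℂ} {R : ℝ} (hR : 0 ≤ R)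
    (hf : IntegrableOn f (Metric.ball 0 R)) (hc : Measurable ((Metric.ball 0 R).indicator f)) :
    ∫ t in Metric.ball (0 : ℂ) R, f t =
      ∫ r in (0 : ℝ)..R, (2 * Real.pi * r : ℝ) • Real.circleAverage f 0 r := by
  have hcm : Measurable fun p : ℝ × ℝ => circleMap 0 p.1 p.2 := by
    unfold circleMap; fun_prop
  have hmeas : Measurable fun p : ℝ × ℝ =>
      p.1 • (Metric.ball 0 R).indicator f (circleMap 0 p.1 p.2) :=
    measurable_fst.smul (hc.comp hcm)
  have hint : IntegrableOn (fun p : ℝ × ℝ =>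
      p.1 • (Metric.ball 0 R).indicator f (circleMap 0 p.1 p.2))
      (Set.Ioi 0 ×ˢ Set.Ioo (-Real.pi) Real.pi) := by
    refine ⟨hmeas.aestronglyMeasurable, ?_⟩
    have h1 := (integrable_indicator_iff measurableSet_ball).2 hf
    have h2 := h1.2
    rw [HasFiniteIntegral, ← Complex.lintegral_comp_polarCoord_symm,
      polarCoord_target] at h2
    refine lt_of_le_of_lt (le_of_eq ?_) h2
    refine setLIntegral_congr_fun (measurableSet_Ioi.prod measurableSet_Ioo) fun p hp => ?_
    simp only [enorm_smul, Complex.polarCoord_symm_eq_circleMap, smul_eq_mul]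
    rw [Real.enorm_of_nonneg (le_of_lt hp.1)]
  rw [← integral_indicator measurableSet_ball, ← Complex.integral_comp_polarCoord_symm,
    polarCoord_target]
  simp only [Complex.polarCoord_symm_eq_circleMap]
  rw [Measure.volume_eq_prod, setIntegral_prod _ hint, intervalIntegral.integral_of_le hR,
    integral_Ioc_eq_integral_Ioo, ← integral_indicator measurableSet_Ioi,
    ← integral_indicator measurableSet_Ioo]
  congr 1
  ext r
  have key : ∀ θ, (Metric.ball (0 : ℂ) R).indicator f (circleMap 0 r θ) =
      if |r| < R then f (circleMap 0 r θ) else 0 := fun θ => by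
    classical
    rw [Set.indicator_apply]
    simp
  simp only [Set.indicator_apply (Set.Ioi _), Set.indicator_apply (Set.Ioo _ _), Set.mem_Ioi,
    Set.mem_Ioo, key]
  by_cases h0 : 0 < r
  · by_cases h1 : r < R
    · simp only [h0, h1, abs_of_pos h0, if_true, and_self]
      rw [integral_smul, ← integral_Ioc_eq_integral_Ioo,
        ← intervalIntegral.integral_of_le (by linarith [Real.pi_pos]),
        Real.intervalIntegral_circleMap_eq_circleAverage, smul_smul]
      congr 1
      ring
    · simp [h0, h1, abs_of_pos h0]
  · simp [h0]

/-! ### The disc kernel and the Forelli-Rudin estimate. -/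

/-- The Bergman kernel of the unit disc, up to the factor `π⁻¹`. -/
noncomputable def diskKernel (v t : ℂ) : ℂ := ((1 - v * conj t) ^ 2)⁻¹

theorem continuous_poissonKernel_circleMap {w : ℂ} (hw : ‖w‖ < 1) :
    Continuous fun θ : ℝ => poissonKernel 0 w (circleMap 0 1 θ) := by
  unfold poissonKernel
  refine Continuous.div (by fun_prop) (by fun_prop) fun θ => ?_
  have : circleMap 0 1 θ - w ≠ 0 := by
    intro h
    have := norm_circleMap_zero 1 θ
    rw [sub_eq_zero.1 h] at this
    simp at this
    linarith
  simpa using this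

theorem integral_poissonKernel {w : ℂ} (hw : ‖w‖ < 1) :
    ∫ θ in (-Real.pi)..Real.pi, poissonKernel 0 w (circleMap 0 1 θ) = 2 * Real.pi := by
  have h := (diffContOnCl_const (c := (1 : ℂ)) (s := Metric.ball (0 : ℂ) 1)
    (𝕜 := ℂ)).circleAverage_poissonKernel_smul (w := w) (R := 1) (by simpa using hw)
  have h' := Real.intervalIntegral_circleMap_eq_circleAverage
    ((poissonKernel 0 w : ℂ → ℝ) • fun _ : ℂ => (1 : ℂ)) 0 1
  rw [h] at h'
  have : ∀ θ, ((poissonKernel 0 w : ℂ → ℝ) • fun _ : ℂ => (1 : ℂ)) (circleMap 0 1 θ) =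
      ((poissonKernel 0 w (circleMap 0 1 θ) : ℝ) : ℂ) := fun θ => by simp
  simp only [this, intervalIntegral.integral_ofReal] at h'
  simp only [Complex.real_smul, mul_one] at h'
  exact_mod_cast h'

/-- If `t = r ζ` with `|ζ| = 1`, then `|1 - v conj t| = |ζ - v r|`. So on a circle the modulus of
the disc kernel is a multiple of the Poisson kernel at `v r`, and its angular integral is known
exactly. -/
theorem norm_diskKernel_circleMap {v : ℂ} {r : ℝ} (hw : ‖v‖ * r < 1) (hr : 0 ≤ r) (θ : ℝ) :
    ‖diskKernel v (circleMap 0 r θ)‖ =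
      (1 - ‖v‖ ^ 2 * r ^ 2)⁻¹ * poissonKernel 0 (v * r) (circleMap 0 1 θ) := by
  have he : ‖circleMap 0 1 θ‖ = 1 := by simp
  have hc : circleMap 0 r θ = r * circleMap 0 1 θ := by simp [circleMap]
  have h1 : circleMap 0 1 θ * (1 - v * conj (circleMap 0 r θ)) = circleMap 0 1 θ - v * r := by
    rw [hc, map_mul, Complex.conj_ofReal, mul_sub, mul_one]
    have : circleMap 0 1 θ * conj (circleMap 0 1 θ) = 1 := by
      rw [Complex.mul_conj, Complex.normSq_eq_norm_sq, he]; simp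
    linear_combination (-v * r) * this
  have h2 : ‖1 - v * conj (circleMap 0 r θ)‖ = ‖circleMap 0 1 θ - v * r‖ := by
    rw [← h1, norm_mul, he, one_mul]
  have h3 : ‖v * (r : ℂ)‖ ^ 2 = ‖v‖ ^ 2 * r ^ 2 := by simp [mul_pow]
  have h4 : (1 - ‖v‖ ^ 2 * r ^ 2) ≠ 0 := by
    have : ‖v‖ * r * (‖v‖ * r) < 1 := by
      have := mul_nonneg (norm_nonneg v) hr
      nlinarith
    nlinarith
  rw [diskKernel, norm_inv, norm_pow, h2, poissonKernel_def]
  simp only [sub_zero, he, h3]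
  field_simp

theorem lintegral_diskKernel_circleMap {v : ℂ} (hv : ‖v‖ < 1) {r : ℝ} (h0 : 0 ≤ r) (h1 : r < 1) :
    ∫⁻ θ in Set.Ioo (-Real.pi) Real.pi, ‖diskKernel v (circleMap 0 r θ)‖ₑ =
      ENNReal.ofReal (2 * Real.pi * (1 - ‖v‖ ^ 2 * r ^ 2)⁻¹) := by
  have hw : ‖v‖ * r < 1 := by nlinarith [norm_nonneg v]
  have hw' : ‖v * (r : ℂ)‖ < 1 := by simpa [abs_of_nonneg h0] using hw
  have hc := continuous_poissonKernel_circleMap hw'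
  simp only [← ofReal_norm, norm_diskKernel_circleMap hw h0]
  rw [← ofReal_integral_eq_lintegral_ofReal, integral_const_mul, ← integral_Ioc_eq_integral_Ioo,
    ← intervalIntegral.integral_of_le (by linarith [Real.pi_pos]), integral_poissonKernel hw',
    mul_comm]
  · exact ((hc.const_mul _).integrableOn_Icc).mono_set Set.Ioo_subset_Icc_self
  · refine Filter.Eventually.of_forall fun θ => ?_
    simp only [← norm_diskKernel_circleMap hw h0, Pi.zero_apply]
    positivity

/-- Splitting at `s = δ` leaves two power integrals: `c < 1` gives convergence at `0` and the
constant `(1 - c)⁻¹`, while `0 < c` gives convergence at infinity and the constant `c⁻¹`. -/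
theorem lintegral_Ioi_rpow_neg_div_max {c : ℝ} (h0 : 0 < c) (h1 : c < 1) :
    ∃ C : ℝ, 0 ≤ C ∧ ∀ δ : ℝ, 0 < δ →
      ∫⁻ s in Set.Ioi (0 : ℝ), ENNReal.ofReal (s ^ (-c) * (max δ s)⁻¹) ≤
        ENNReal.ofReal (C * δ ^ (-c)) := by
  refine ⟨(1 - c)⁻¹ + c⁻¹, by
    have : 0 ≤ (1 - c)⁻¹ := inv_nonneg.2 (by linarith)
    positivity, fun δ hδ => ?_⟩
  have h1' : 0 < 1 - c := by linarith
  rw [← Set.Ioc_union_Ioi_eq_Ioi hδ.le]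
  refine (lintegral_union_le _ _ _).trans ?_
  rw [add_mul, ENNReal.ofReal_add (by positivity) (by positivity)]
  have hA : IntervalIntegrable (fun s : ℝ => s ^ (-c)) volume 0 δ :=
    intervalIntegral.intervalIntegrable_rpow' (by linarith)
  refine add_le_add ?_ ?_
  · have : ∀ s ∈ Set.Ioc 0 δ, ENNReal.ofReal (s ^ (-c) * (max δ s)⁻¹) =
        ENNReal.ofReal (s ^ (-c) * δ⁻¹) := fun s hs => by rw [max_eq_left hs.2]
    rw [setLIntegral_congr_fun measurableSet_Ioc this, ← ofReal_integral_eq_lintegral_ofReal,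
      integral_mul_const, ← intervalIntegral.integral_of_le hδ.le, integral_rpow (by grind)]
    · refine le_of_eq ?_
      congr 1
      rw [Real.zero_rpow (by linarith), Real.rpow_add hδ, Real.rpow_one]
      rw [neg_add_eq_sub]
      field_simp
      ring
    · exact (((intervalIntegrable_iff_integrableOn_Ioc_of_le hδ.le).1 hA).mul_const _)
    · refine (ae_restrict_iff' measurableSet_Ioc).2 (Filter.Eventually.of_forall fun s hs => ?_)
      have := hs.1
      simp only [Pi.zero_apply]
      positivity
  · have : ∀ s ∈ Set.Ioi δ, ENNReal.ofReal (s ^ (-c) * (max δ s)⁻¹) =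
        ENNReal.ofReal (s ^ (-c - 1)) := fun s hs => by
      have hs' : 0 < s := hδ.trans hs
      rw [max_eq_right (le_of_lt hs), Real.rpow_sub_one hs'.ne', div_eq_mul_inv]
    rw [setLIntegral_congr_fun measurableSet_Ioi this, ← ofReal_integral_eq_lintegral_ofReal,
      integral_Ioi_rpow_of_lt (by linarith) hδ]
    · refine le_of_eq ?_
      congr 1
      rw [sub_add_cancel]
      field_simp
    · exact integrableOn_Ioi_rpow_of_lt (by linarith) hδ
    · refine (ae_restrict_iff' measurableSet_Ioi).2 (Filter.Eventually.of_forall fun s hs => ?_)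
      have : 0 < s := hδ.trans hs
      simp only [Pi.zero_apply]
      positivity

theorem lintegral_Ioo_rpow_lt_top {e : ℝ} (he : -1 < e) :
    ∫⁻ r in Set.Ioo (0 : ℝ) 1, ENNReal.ofReal (r ^ e) < ∞ := by
  have hA : IntervalIntegrable (fun s : ℝ => s ^ e) volume 0 1 :=
    intervalIntegral.intervalIntegrable_rpow' he
  have h := (((intervalIntegrable_iff_integrableOn_Ioc_of_le zero_le_one).1 hA).mono_set
    Set.Ioo_subset_Ioc_self)
  exact h.lintegral_lt_top

/-- The pointwise bound behind the Forelli-Rudin estimate. -/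
theorem rpow_mul_rpow_div_le {c d a r : ℝ} (h0 : 0 < c) (ha0 : 0 ≤ a) (ha : a < 1)
    (hr0 : 0 < r) (hr : r < 1) :
    r * ((2 * Real.pi * (1 - a * r ^ 2)⁻¹) * ((1 - r ^ 2) ^ (-c) * r ^ d)) ≤
      2 * Real.pi * 2 ^ (c + 1) * (1 - a) ^ (-c) * r ^ (d + 1) +
        2 * Real.pi * max 1 (2 ^ (-(d + 1))) * ((1 - r) ^ (-c) * (max (1 - a) (1 - r))⁻¹) := by
  have hs : 0 < 1 - r := by linarith
  have hδ : 0 < 1 - a := by linarith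
  have h2 : 1 - r ≤ 1 - r ^ 2 := by nlinarith
  have hmax : max (1 - a) (1 - r) ≤ 1 - a * r ^ 2 := by
    refine max_le ?_ ?_ <;> nlinarith [mul_nonneg ha0 hr0.le, sq_nonneg r]
  have hmpos : 0 < max (1 - a) (1 - r) := lt_max_of_lt_left hδ
  have e1 : (1 - a * r ^ 2)⁻¹ ≤ (max (1 - a) (1 - r))⁻¹ := inv_anti₀ hmpos hmax
  have e2 : (1 - r ^ 2) ^ (-c) ≤ (1 - r) ^ (-c) :=
    Real.rpow_le_rpow_of_nonpos hs h2 (by linarith)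
  have e3 : r * r ^ d = r ^ (d + 1) := by rw [Real.rpow_add_one hr0.ne', mul_comm]
  have e4 : r * ((2 * Real.pi * (1 - a * r ^ 2)⁻¹) * ((1 - r ^ 2) ^ (-c) * r ^ d)) ≤
      2 * Real.pi * ((max (1 - a) (1 - r))⁻¹ * ((1 - r) ^ (-c) * r ^ (d + 1))) := by
    rw [← e3]
    calc _ ≤ r * ((2 * Real.pi * (max (1 - a) (1 - r))⁻¹) * ((1 - r) ^ (-c) * r ^ d)) := by
          have : 0 ≤ (1 - r ^ 2) ^ (-c) := Real.rpow_nonneg (by linarith) _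
          gcongr
      _ = _ := by ring
  refine e4.trans ?_
  -- Up to `1/2` only the factor `r ^ (d + 1)` can be singular, and beyond `1/2` it is bounded; each
  -- half is absorbed by one of the two summands.
  rcases le_total r (1 / 2) with hr2 | hr2
  · have e5 : (max (1 - a) (1 - r))⁻¹ ≤ 2 := by
      rw [inv_le_comm₀ hmpos two_pos]
      exact le_max_of_le_right (by linarith)
    have e6 : (1 - r) ^ (-c) ≤ 2 ^ c := by
      calc (1 - r) ^ (-c) ≤ (1 / 2 : ℝ) ^ (-c) :=
            Real.rpow_le_rpow_of_nonpos (by norm_num) (by linarith) (by linarith)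
        _ = 2 ^ c := by rw [Real.rpow_neg (by norm_num), one_div, Real.inv_rpow (by norm_num), inv_inv]
    have e7 : 1 ≤ (1 - a) ^ (-c) := Real.one_le_rpow_of_pos_of_le_one_of_nonpos hδ (by linarith)
      (by linarith)
    refine le_trans ?_ (le_add_of_nonneg_right (by positivity))
    calc 2 * Real.pi * ((max (1 - a) (1 - r))⁻¹ * ((1 - r) ^ (-c) * r ^ (d + 1)))
        ≤ 2 * Real.pi * (2 * (2 ^ c * r ^ (d + 1))) := by gcongr
      _ = 2 * Real.pi * 2 ^ (c + 1) * 1 * r ^ (d + 1) := by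
          rw [Real.rpow_add_one two_ne_zero]; ring
      _ ≤ _ := by gcongr
  · have e5 : r ^ (d + 1) ≤ max 1 (2 ^ (-(d + 1))) := by
      rcases le_total 0 (d + 1) with h | h
      · exact le_max_of_le_left (Real.rpow_le_one hr0.le hr.le h)
      · refine le_max_of_le_right ?_
        calc r ^ (d + 1) ≤ (1 / 2 : ℝ) ^ (d + 1) :=
              Real.rpow_le_rpow_of_nonpos (by norm_num) hr2 h
          _ = _ := by rw [Real.rpow_neg (by norm_num), one_div, Real.inv_rpow (by norm_num)]
    refine le_trans ?_ (le_add_of_nonneg_left (by positivity))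
    calc 2 * Real.pi * ((max (1 - a) (1 - r))⁻¹ * ((1 - r) ^ (-c) * r ^ (d + 1)))
        ≤ 2 * Real.pi * ((max (1 - a) (1 - r))⁻¹ * ((1 - r) ^ (-c) * max 1 (2 ^ (-(d + 1))))) := by
          gcongr
      _ = _ := by ring

/-- **Forelli-Rudin estimate** on the unit disc. -/
theorem lintegral_diskKernel_le {c d : ℝ} (h0 : 0 < c) (h1 : c < 1) (hd : -2 < d) :
    ∃ C : ℝ≥0, ∀ v : ℂ, ‖v‖ < 1 →
      ∫⁻ t in Metric.ball (0 : ℂ) 1,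
        ‖diskKernel v t‖ₑ * ENNReal.ofReal ((1 - ‖t‖ ^ 2) ^ (-c) * ‖t‖ ^ d) ≤
      C * ENNReal.ofReal ((1 - ‖v‖ ^ 2) ^ (-c)) := by
  obtain ⟨C₁, hC₁, H₁⟩ := lintegral_Ioi_rpow_neg_div_max h0 h1
  have H₂ := lintegral_Ioo_rpow_lt_top (e := d + 1) (by linarith)
  set I := ∫⁻ r in Set.Ioo (0 : ℝ) 1, ENNReal.ofReal (r ^ (d + 1)) with hI
  set A : ℝ := 2 * Real.pi * 2 ^ (c + 1)
  set B : ℝ := 2 * Real.pi * max 1 (2 ^ (-(d + 1)))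
  have hA : 0 ≤ A := by positivity
  have hB : 0 ≤ B := by positivity
  refine ⟨(ENNReal.ofReal A * I + ENNReal.ofReal (B * C₁)).toNNReal, fun v hv => ?_⟩
  rw [ENNReal.coe_toNNReal (by finiteness)]
  have hvs : ‖v‖ ^ 2 < 1 := by nlinarith [norm_nonneg v]
  have hδ : 0 < 1 - ‖v‖ ^ 2 := by linarith
  have hm : Measurable fun t : ℂ =>
      ‖diskKernel v t‖ₑ * ENNReal.ofReal ((1 - ‖t‖ ^ 2) ^ (-c) * ‖t‖ ^ d) := by
    unfold diskKernel
    have : Measurable fun t : ℂ => conj t := Complex.continuous_conj.measurable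
    fun_prop
  rw [lintegral_ball_eq_lintegral_circleMap hm]
  calc _ = ∫⁻ r in Set.Ioo (0 : ℝ) 1, ENNReal.ofReal
        (r * ((2 * Real.pi * (1 - ‖v‖ ^ 2 * r ^ 2)⁻¹) * ((1 - r ^ 2) ^ (-c) * r ^ d))) := by
        refine setLIntegral_congr_fun measurableSet_Ioo fun r hr => ?_
        have hr0 := hr.1
        have hp : 0 ≤ (1 - ‖v‖ ^ 2 * r ^ 2)⁻¹ := inv_nonneg.2 (by nlinarith [hr.1, hr.2])
        simp only [norm_circleMap_zero, abs_of_pos hr.1]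
        rw [lintegral_mul_const _ (by
            unfold diskKernel
            have : Measurable fun t : ℂ => conj t := Complex.continuous_conj.measurable
            fun_prop),
          lintegral_diskKernel_circleMap hv hr.1.le hr.2,
          ← ENNReal.ofReal_mul (by positivity), ← ENNReal.ofReal_mul hr.1.le]
    _ ≤ ∫⁻ r in Set.Ioo (0 : ℝ) 1, (ENNReal.ofReal (A * (1 - ‖v‖ ^ 2) ^ (-c)) *
          ENNReal.ofReal (r ^ (d + 1)) + ENNReal.ofReal B *
          ENNReal.ofReal ((1 - r) ^ (-c) * (max (1 - ‖v‖ ^ 2) (1 - r))⁻¹)) := by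
        refine setLIntegral_mono' measurableSet_Ioo fun r hr => ?_
        rw [← ENNReal.ofReal_mul (by positivity), ← ENNReal.ofReal_mul hB,
          ← ENNReal.ofReal_add]
        · exact ENNReal.ofReal_le_ofReal
            (rpow_mul_rpow_div_le h0 (sq_nonneg _) hvs hr.1 hr.2)
        · have := hr.1
          positivity
        · have : 0 < 1 - r := by linarith [hr.2]
          positivity
    _ = ENNReal.ofReal (A * (1 - ‖v‖ ^ 2) ^ (-c)) * I + ENNReal.ofReal B *
          ∫⁻ r in Set.Ioo (0 : ℝ) 1,
            ENNReal.ofReal ((1 - r) ^ (-c) * (max (1 - ‖v‖ ^ 2) (1 - r))⁻¹) := by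
        rw [lintegral_add_left (by fun_prop), lintegral_const_mul _ (by fun_prop),
          lintegral_const_mul _ (by fun_prop)]
    _ ≤ ENNReal.ofReal (A * (1 - ‖v‖ ^ 2) ^ (-c)) * I + ENNReal.ofReal B *
          ENNReal.ofReal (C₁ * (1 - ‖v‖ ^ 2) ^ (-c)) := by
        gcongr
        refine le_trans ?_ (H₁ _ hδ)
        -- The reflection `s = 1 - r` turns the distance to the boundary into the variable of
        -- integration.
        rw [← lintegral_indicator measurableSet_Ioo, ← lintegral_indicator measurableSet_Ioi,
          ← lintegral_sub_left_eq_self _ (1 : ℝ)]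
        refine lintegral_mono fun r => ?_
        simp only [Set.indicator_apply, Set.mem_Ioo, Set.mem_Ioi, sub_sub_cancel]
        split_ifs with h h' <;> first | exact le_rfl | exact bot_le | exact absurd (by linarith [h.2]) h'
    _ = _ := by
        rw [ENNReal.ofReal_mul hA, ENNReal.ofReal_mul hC₁, ENNReal.ofReal_mul hB]
        ring

/-! ### Area mean values and removal of square-integrable singularities. -/

theorem measurable_indicator_of_continuousOn {X : Type*} [TopologicalSpace X] [MeasurableSpace X]
    [BorelSpace X] {f : X → ℂ} {s : Set X} (hs : MeasurableSet s) (hf : ContinuousOn f s) :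
    Measurable (s.indicator f) := by
  classical
  rw [← Set.piecewise_eq_indicator]
  exact hf.measurable_piecewise continuousOn_const hs

/-- The **mean value property** for the area integral over a disc centered at the origin. -/
theorem integral_ball_zero_of_differentiableOn {h : ℂ → ℂ} {R : ℝ} (hR : 0 ≤ R)
    (hd : DifferentiableOn ℂ h (Metric.ball 0 R)) (hi : IntegrableOn h (Metric.ball 0 R)) :
    ∫ t in Metric.ball (0 : ℂ) R, h t = (Real.pi * R ^ 2 : ℝ) • h 0 := by
  rw [integral_ball_eq_integral_circleAverage hR hi
    (measurable_indicator_of_continuousOn measurableSet_ball hd.continuousOn)]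
  have : ∫ r in (0 : ℝ)..R, (2 * Real.pi * r : ℝ) • Real.circleAverage h 0 r =
      ∫ r in (0 : ℝ)..R, (2 * Real.pi * r : ℝ) • h 0 := by
    refine intervalIntegral.integral_congr_ae ?_
    -- The radius `R` itself is left out, because `h` is holomorphic only on the open disc.
    filter_upwards [Measure.ae_ne volume R] with r hr hr'
    rw [Set.uIoc_of_le hR] at hr'
    have hrR : r < R := lt_of_le_of_ne hr'.2 hr
    rw [DiffContOnCl.circleAverage]
    refine DifferentiableOn.diffContOnCl (hd.mono ?_)
    refine Metric.closure_ball_subset_closedBall.trans (Metric.closedBall_subset_ball ?_)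
    rwa [abs_of_pos hr'.1]
  rw [this, intervalIntegral.integral_smul_const, intervalIntegral.integral_const_mul, integral_id]
  congr 1
  ring

theorem integral_ball_of_differentiableOn {h : ℂ → ℂ} {z : ℂ} {R : ℝ} (hR : 0 ≤ R)
    (hd : DifferentiableOn ℂ h (Metric.ball z R)) (hi : IntegrableOn h (Metric.ball z R)) :
    ∫ t in Metric.ball z R, h t = (Real.pi * R ^ 2 : ℝ) • h z := by
  have hp : MeasurePreserving (fun t : ℂ => z + t) volume volume := measurePreserving_add_left _ z
  have he : MeasurableEmbedding (fun t : ℂ => z + t) := measurableEmbedding_addLeft z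
  have hb : (fun t : ℂ => z + t) ⁻¹' Metric.ball z R = Metric.ball 0 R := by
    ext t; simp
  rw [← hp.setIntegral_preimage_emb he, hb, integral_ball_zero_of_differentiableOn hR]
  · simp
  · refine hd.comp (by fun_prop) fun t ht => ?_
    rwa [← hb] at ht
  · rw [← hb]
    exact (hp.integrableOn_comp_preimage he).2 hi

-- The mean value property of `h ^ 2` on the disc about `z` of radius `‖z‖ / 2` bounds `(‖z‖ * ‖h
-- z‖) ^ 2` by a constant times the integral of `‖h‖ ^ 2` over a disc of radius `2 * ‖z‖`. That
-- integral tends to `0` with the area of the disc.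
open Filter Topology in
theorem isLittleO_inv_of_sq_integrable {h : ℂ → ℂ}
    (hd : DifferentiableOn ℂ h (Metric.ball 0 1 \ {0}))
    (hi : IntegrableOn (fun t => ‖h t‖ ^ 2) (Metric.ball 0 1)) :
    h =o[𝓝[≠] 0] fun z => z⁻¹ := by
  have key : ∀ z : ℂ, z ≠ 0 → ‖z‖ < 1 / 2 →
      (‖z‖ * ‖h z‖) ^ 2 ≤ 4 / Real.pi * ∫ t in Metric.ball 0 (2 * ‖z‖), ‖h t‖ ^ 2 := by
    intro z hz0 hz
    have hz1 : 0 < ‖z‖ := norm_pos_iff.2 hz0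
    have hsub0 : Metric.ball z (‖z‖ / 2) ⊆ Metric.ball 0 (2 * ‖z‖) := by
      intro t ht
      rw [mem_ball_iff_norm] at ht
      rw [mem_ball_zero_iff]
      calc ‖t‖ = ‖(t - z) + z‖ := by simp
        _ ≤ ‖t - z‖ + ‖z‖ := norm_add_le _ _
        _ < 2 * ‖z‖ := by linarith
    have hsub1 : Metric.ball (0 : ℂ) (2 * ‖z‖) ⊆ Metric.ball 0 1 :=
      Metric.ball_subset_ball (by linarith)
    have hsub2 : Metric.ball z (‖z‖ / 2) ⊆ Metric.ball 0 1 \ {0} := by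
      intro t ht
      refine ⟨hsub1 (hsub0 ht), ?_⟩
      rintro rfl
      rw [mem_ball_iff_norm] at ht
      simp at ht
      linarith
    have hdd : DifferentiableOn ℂ (fun t => h t ^ 2) (Metric.ball z (‖z‖ / 2)) :=
      (hd.mono hsub2).pow 2
    have hii : IntegrableOn (fun t => h t ^ 2) (Metric.ball z (‖z‖ / 2)) := by
      have h1 : IntegrableOn (fun t => ‖h t‖ ^ 2) (Metric.ball z (‖z‖ / 2)) :=
        hi.mono_set (hsub0.trans hsub1)
      refine h1.mono' (hdd.continuousOn.aestronglyMeasurable measurableSet_ball) ?_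
      exact Eventually.of_forall fun t => by simp
    have hm := integral_ball_of_differentiableOn (by positivity) hdd hii
    have h2 : ‖∫ t in Metric.ball z (‖z‖ / 2), h t ^ 2‖ ≤
        ∫ t in Metric.ball 0 (2 * ‖z‖), ‖h t‖ ^ 2 := by
      refine (norm_integral_le_integral_norm _).trans ?_
      simp only [norm_pow]
      exact setIntegral_mono_set (hi.mono_set hsub1)
        (Eventually.of_forall fun t => by positivity) (LE.le.eventuallyLE hsub0)
    rw [hm, norm_smul, norm_pow, Real.norm_of_nonneg (by positivity)] at h2
    calc (‖z‖ * ‖h z‖) ^ 2 = 4 / Real.pi * (Real.pi * (‖z‖ / 2) ^ 2 * ‖h z‖ ^ 2) := by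
          field_simp; ring
      _ ≤ _ := by gcongr
  have hlim : Tendsto (fun z : ℂ => 4 / Real.pi * ∫ t in Metric.ball 0 (2 * ‖z‖), ‖h t‖ ^ 2)
      (𝓝[≠] 0) (𝓝 0) := by
    rw [← mul_zero (4 / Real.pi)]
    refine Tendsto.const_mul _ ?_
    have hvol : Tendsto (fun z : ℂ => (volume.restrict (Metric.ball (0 : ℂ) 1))
        (Metric.ball 0 (2 * ‖z‖))) (𝓝[≠] 0) (𝓝 0) := by
      have : Tendsto (fun z : ℂ => volume (Metric.ball (0 : ℂ) (2 * ‖z‖))) (𝓝[≠] 0) (𝓝 0) := by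
        simp only [Complex.volume_ball]
        have hc : Continuous fun z : ℂ => ENNReal.ofReal (2 * ‖z‖) ^ 2 * NNReal.pi := by
          refine ENNReal.continuous_mul_const (by simp) |>.comp ?_
          exact (ENNReal.continuous_pow 2).comp (ENNReal.continuous_ofReal.comp (by fun_prop))
        have := hc.tendsto 0
        rw [norm_zero, mul_zero, ENNReal.ofReal_zero, zero_pow two_ne_zero, zero_mul] at this
        exact this.mono_left nhdsWithin_le_nhds
      refine tendsto_of_tendsto_of_tendsto_of_le_of_le tendsto_const_nhds this
        (fun _ => bot_le) fun z => Measure.restrict_apply_le _ _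
    have := hi.tendsto_setIntegral_nhds_zero hvol
    refine this.congr' ?_
    have hev : ∀ᶠ z : ℂ in 𝓝[≠] 0, ‖z‖ < 1 / 2 := by
      refine nhdsWithin_le_nhds ?_
      filter_upwards [Metric.ball_mem_nhds (0 : ℂ) (by norm_num : (0 : ℝ) < 1 / 2)] with z hz
      simpa using hz
    filter_upwards [hev] with z hz
    rw [Measure.restrict_restrict measurableSet_ball, Set.inter_eq_left.2]
    exact Metric.ball_subset_ball (by linarith)
  have h1 : Tendsto (fun z : ℂ => (‖z‖ * ‖h z‖) ^ 2) (𝓝[≠] 0) (𝓝 0) := by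
    refine squeeze_zero' (Eventually.of_forall fun z => by positivity) ?_ hlim
    have hev : ∀ᶠ z : ℂ in 𝓝[≠] 0, ‖z‖ < 1 / 2 := by
      refine nhdsWithin_le_nhds ?_
      filter_upwards [Metric.ball_mem_nhds (0 : ℂ) (by norm_num : (0 : ℝ) < 1 / 2)] with z hz
      simpa using hz
    filter_upwards [hev, self_mem_nhdsWithin] with z hz hz0
    exact key z hz0 hz
  have h2 : Tendsto (fun z : ℂ => ‖z‖ * ‖h z‖) (𝓝[≠] 0) (𝓝 0) := by
    have := h1.sqrt
    rw [Real.sqrt_zero] at this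
    exact this.congr fun z => Real.sqrt_sq (by positivity)
  rw [Asymptotics.isLittleO_iff_tendsto' (by
    filter_upwards [self_mem_nhdsWithin] with z hz hz'
    exact absurd (inv_eq_zero.1 hz') hz)]
  rw [tendsto_zero_iff_norm_tendsto_zero]
  refine h2.congr fun z => ?_
  rw [norm_div, norm_inv, div_inv_eq_mul, mul_comm]

open Filter Topology in
/-- A square-integrable holomorphic function on the punctured unit disc extends holomorphically
to the disc. -/
theorem exists_differentiableOn_extension_of_sq_integrable {h : ℂ → ℂ}
    (hd : DifferentiableOn ℂ h (Metric.ball 0 1 \ {0}))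
    (hi : IntegrableOn (fun t => ‖h t‖ ^ 2) (Metric.ball 0 1)) :
    ∃ H : ℂ → ℂ, DifferentiableOn ℂ H (Metric.ball 0 1) ∧ ∀ z ≠ 0, H z = h z := by
  have ho := isLittleO_inv_of_sq_integrable hd hi
  refine ⟨_, Complex.differentiableOn_update_limUnder_of_isLittleO
    (Metric.ball_mem_nhds (0 : ℂ) one_pos) hd ?_, fun z hz => Function.update_of_ne hz _ _⟩
  simp only [sub_zero]
  -- The removable singularity theorem asks about `h z - h 0`; the constant `h 0` is negligible
  -- against `z⁻¹`.
  refine ho.sub ?_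
  refine Asymptotics.isLittleO_const_left.2 (Or.inr ?_)
  have := (tendsto_norm_inv_nhdsNE_zero_atTop (α := ℂ))
  exact this

/-! ### The reproducing property of the disc kernel. -/

theorem one_sub_norm_le_norm_one_sub_mul_conj {v t : ℂ} (ht : ‖t‖ ≤ 1) :
    1 - ‖v‖ ≤ ‖1 - v * conj t‖ := by
  have h1 : ‖v * conj t‖ ≤ ‖v‖ := by
    rw [norm_mul, RCLike.norm_conj]
    exact mul_le_of_le_one_right (norm_nonneg _) ht
  have h2 := norm_sub_norm_le (1 : ℂ) (v * conj t)
  rw [norm_one] at h2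
  linarith

theorem one_sub_mul_conj_ne_zero {v t : ℂ} (hv : ‖v‖ < 1) (ht : ‖t‖ ≤ 1) :
    1 - v * conj t ≠ 0 := by
  have := one_sub_norm_le_norm_one_sub_mul_conj (v := v) ht
  intro h
  rw [h, norm_zero] at this
  linarith

theorem norm_diskKernel_le {v t : ℂ} (hv : ‖v‖ < 1) (ht : ‖t‖ ≤ 1) :
    ‖diskKernel v t‖ ≤ ((1 - ‖v‖) ^ 2)⁻¹ := by
  rw [diskKernel, norm_inv, norm_pow]
  have h1 : 0 < 1 - ‖v‖ := by linarith
  have := one_sub_norm_le_norm_one_sub_mul_conj (v := v) ht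
  gcongr

theorem measurable_diskKernel_comp {X : Type*} [MeasurableSpace X] {f g : X → ℂ} (hf : Measurable f)
    (hg : Measurable g) : Measurable fun x => diskKernel (f x) (g x) := by
  unfold diskKernel
  have : Measurable fun t : ℂ => conj t := Complex.continuous_conj.measurable
  fun_prop

instance isFiniteMeasure_restrict_ball (c : ℂ) (r : ℝ) :
    IsFiniteMeasure (volume.restrict (Metric.ball c r)) :=
  ⟨by rw [Measure.restrict_apply_univ]; exact measure_ball_lt_top⟩

/-- On the circle `|t| = r` one has `conj t = r² / t`, so the kernel equals `t² / (t - v r²)²`. With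
`dt / t` from the average, this is Cauchy's formula for the derivative of `z H(z)` at `v r²`. -/
theorem circleAverage_diskKernel_mul {H : ℂ → ℂ} (hd : DifferentiableOn ℂ H (Metric.ball 0 1))
    {v : ℂ} (hv : ‖v‖ < 1) {r : ℝ} (h0 : 0 < r) (h1 : r < 1) :
    Real.circleAverage (fun t => diskKernel v t * H t) 0 r =
      deriv (fun z => z * H z) (v * r ^ 2) := by
  have hmem : v * (r : ℂ) ^ 2 ∈ Metric.ball (0 : ℂ) r := by
    rw [mem_ball_zero_iff, norm_mul, norm_pow, Complex.norm_real, Real.norm_of_nonneg h0.le]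
    nlinarith [norm_nonneg v]
  rw [Real.circleAverage_eq_circleIntegral h0.ne',
    ← Complex.two_pi_I_inv_smul_circleIntegral_sub_sq_inv_smul_of_differentiable
      Metric.isOpen_ball (Metric.closedBall_subset_ball h1)
      (f := fun z => z * H z) (differentiableOn_id.fun_mul hd) hmem]
  congr 1
  refine circleIntegral.integral_congr h0.le fun z hz => ?_
  have hz' : ‖z‖ = r := by simpa using hz
  have hz0 : z ≠ 0 := by rw [← norm_pos_iff, hz']; exact h0
  have hzc : z * conj z = (r : ℂ) ^ 2 := by
    rw [Complex.mul_conj, Complex.normSq_eq_norm_sq, hz']; norm_cast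
  have hne : 1 - v * conj z ≠ 0 := one_sub_mul_conj_ne_zero hv (by rw [hz']; exact h1.le)
  have he : z - v * (r : ℂ) ^ 2 = z * (1 - v * conj z) := by rw [← hzc]; ring
  simp only [sub_zero, smul_eq_mul, diskKernel, he]
  field_simp

theorem integrable_of_sq_integrable {X : Type*} [MeasurableSpace X] {μ : Measure X}
    [IsFiniteMeasure μ] {f : X → ℂ} (hm : AEStronglyMeasurable f μ)
    (hi : Integrable (fun t => ‖f t‖ ^ 2) μ) : Integrable f μ :=
  ((memLp_two_iff_integrable_sq_norm hm).2 hi).integrable (by norm_num)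

/-- The reproducing property of the Bergman kernel of the disc, for functions on the disc. -/
theorem integral_diskKernel_mul_of_differentiableOn {H : ℂ → ℂ}
    (hd : DifferentiableOn ℂ H (Metric.ball 0 1))
    (hi : IntegrableOn (fun t => ‖H t‖ ^ 2) (Metric.ball 0 1)) {v : ℂ} (hv0 : v ≠ 0)
    (hv : ‖v‖ < 1) :
    ∫ t in Metric.ball (0 : ℂ) 1, diskKernel v t * H t = Real.pi * H v := by
  have hH : IntegrableOn H (Metric.ball 0 1) := integrable_of_sq_integrable
    (hd.continuousOn.aestronglyMeasurable measurableSet_ball) hi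
  have hcont : ContinuousOn (fun t => diskKernel v t * H t) (Metric.ball 0 1) := by
    refine ContinuousOn.mul ?_ hd.continuousOn
    unfold diskKernel
    refine ContinuousOn.inv₀ (by fun_prop) fun t ht => pow_ne_zero _ ?_
    exact one_sub_mul_conj_ne_zero hv (by simpa using (mem_ball_zero_iff.1 ht).le)
  have hint : IntegrableOn (fun t => diskKernel v t * H t) (Metric.ball 0 1) := by
    refine Integrable.bdd_mul (c := ((1 - ‖v‖) ^ 2)⁻¹) hH
      (measurable_diskKernel_comp measurable_const measurable_id).aestronglyMeasurable ?_
    refine (ae_restrict_iff' measurableSet_ball).2 (Filter.Eventually.of_forall fun t ht => ?_)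
    exact norm_diskKernel_le hv (mem_ball_zero_iff.1 ht).le
  rw [integral_ball_eq_integral_circleAverage zero_le_one hint
    (measurable_indicator_of_continuousOn measurableSet_ball hcont)]
  set G : ℂ → ℂ := fun z => z * H z with hG
  have hGd : DifferentiableOn ℂ G (Metric.ball 0 1) := differentiableOn_id.fun_mul hd
  have hG' : ContinuousOn (deriv G) (Metric.ball 0 1) :=
    (hGd.deriv Metric.isOpen_ball).continuousOn
  have hmaps : ∀ r ∈ Set.uIcc (0 : ℝ) 1, v * (r : ℂ) ^ 2 ∈ Metric.ball (0 : ℂ) 1 := by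
    intro r hr
    rw [Set.uIcc_of_le zero_le_one] at hr
    rw [mem_ball_zero_iff, norm_mul, norm_pow, Complex.norm_real, Real.norm_of_nonneg hr.1]
    exact lt_of_le_of_lt (mul_le_of_le_one_right (norm_nonneg v) (pow_le_one₀ hr.1 hr.2)) hv
  -- After the circle average, the radial integrand is the derivative of `(π / v) G(v r²)`, so the
  -- fundamental theorem of calculus gives `(π / v) G(v) = π H(v)`. The division by `v` is the
  -- reason for the hypothesis `v ≠ 0`.
  have h1 : ∫ r in (0 : ℝ)..1, (2 * Real.pi * r : ℝ) •
        Real.circleAverage (fun t => diskKernel v t * H t) 0 r =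
      ∫ r in (0 : ℝ)..1, (Real.pi / v) * (deriv G (v * r ^ 2) * (v * (2 * r))) := by
    refine intervalIntegral.integral_congr_ae ?_
    filter_upwards [Measure.ae_ne volume (1 : ℝ)] with r hr hr'
    rw [Set.uIoc_of_le zero_le_one] at hr'
    rw [circleAverage_diskKernel_mul hd hv hr'.1 (lt_of_le_of_ne hr'.2 hr), Complex.real_smul]
    push_cast
    rw [← hG]
    field_simp
  rw [h1, intervalIntegral.integral_const_mul,
    intervalIntegral.integral_eq_sub_of_hasDerivAt (f := fun r : ℝ => G (v * r ^ 2))]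
  · simp [hG]
    field_simp
  · intro r hr
    have ha : HasDerivAt (fun r : ℝ => v * (r : ℂ) ^ 2) (v * (2 * r)) r := by
      have := ((Complex.ofRealCLM.hasDerivAt (x := r)).pow 2).const_mul v
      simpa using this
    have hb := ((hGd.differentiableAt (Metric.isOpen_ball.mem_nhds (hmaps r hr))).hasDerivAt)
    exact hb.comp r ha
  · refine ContinuousOn.intervalIntegrable ?_
    exact (hG'.comp (by fun_prop) hmaps).mul (by fun_prop)

/-- The reproducing property of the Bergman kernel of the disc, for functions on the punctured
disc. -/
theorem integral_diskKernel_mul {h : ℂ → ℂ}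
    (hd : DifferentiableOn ℂ h (Metric.ball 0 1 \ {0}))
    (hi : IntegrableOn (fun t => ‖h t‖ ^ 2) (Metric.ball 0 1)) {v : ℂ} (hv0 : v ≠ 0)
    (hv : ‖v‖ < 1) :
    ∫ t in Metric.ball (0 : ℂ) 1, diskKernel v t * h t = Real.pi * h v := by
  obtain ⟨H, hH, hHh⟩ := exists_differentiableOn_extension_of_sq_integrable hd hi
  have hae : ∀ᵐ t ∂(volume.restrict (Metric.ball (0 : ℂ) 1)), H t = h t := by
    filter_upwards [Measure.ae_ne (volume.restrict (Metric.ball (0 : ℂ) 1)) 0] with t ht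
      using hHh t ht
  rw [← hHh v hv0, ← integral_diskKernel_mul_of_differentiableOn hH _ hv0 hv]
  · exact integral_congr_ae (hae.mono fun t ht => by simp only [ht])
  · exact hi.congr (hae.mono fun t ht => by simp only [ht])

/-! ### Change of variables between the bidisc and the Hartogs triangle. -/

/-- The real determinant of multiplication by `v` is the algebra norm of `v`, which is `‖v‖ ^ 2`. -/
theorem Complex.lintegral_comp_mul_right {v : ℂ} (hv : v ≠ 0) {g : ℂ → ℝ≥0∞} (hg : Measurable g) :
    ∫⁻ z, g z = ‖v‖ₑ ^ 2 * ∫⁻ u, g (u * v) := by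
  have hdet : LinearMap.det (LinearMap.mulLeft ℝ v) = ‖v‖ ^ 2 := by
    have := Algebra.norm_complex_apply v
    rw [Algebra.norm_apply, Complex.normSq_eq_norm_sq] at this
    exact this
  have h0 : 0 < ‖v‖ ^ 2 := by positivity
  have hmap := Measure.map_linearMap_addHaar_eq_smul_addHaar (volume : Measure ℂ)
    (f := LinearMap.mulLeft ℝ v) (by rw [hdet]; exact h0.ne')
  have h1 : ∫⁻ u, g (u * v) = ENNReal.ofReal (‖v‖ ^ 2)⁻¹ * ∫⁻ z, g z := by
    rw [hdet, abs_of_nonneg (by positivity)] at hmap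
    rw [← smul_eq_mul, ← lintegral_smul_measure, ← hmap, lintegral_map hg (by
      exact (continuous_const_mul v).measurable)]
    simp [mul_comm]
  rw [h1, ← mul_assoc, ENNReal.ofReal_inv_of_pos h0, ENNReal.ofReal_pow (norm_nonneg v), ofReal_norm,
    ENNReal.mul_inv_cancel, one_mul]
  · simpa using hv
  · finiteness

/-- The biholomorphism from the product of the disc with the punctured disc onto the Hartogs
triangle. -/
def hartogsMap (p : ℂ × ℂ) : ℂ × ℂ := (p.1 * p.2, p.2)

theorem measurable_hartogsMap : Measurable hartogsMap := by
  unfold hartogsMap; fun_prop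

theorem isOpen_hartogsTriangle : IsOpen hartogsTriangle := by
  have h1 : IsOpen {z : ℂ × ℂ | ‖z.1‖ < ‖z.2‖} := isOpen_lt (by fun_prop) (by fun_prop)
  have h2 : IsOpen {z : ℂ × ℂ | ‖z.2‖ < 1} := isOpen_lt (by fun_prop) (by fun_prop)
  exact h1.inter h2

theorem measurableSet_hartogsTriangle : MeasurableSet hartogsTriangle :=
  isOpen_hartogsTriangle.measurableSet

/-- Lebesgue measure on the bidisc. -/
noncomputable def bidiscMeasure : Measure (ℂ × ℂ) :=
  (volume.restrict (Metric.ball (0 : ℂ) 1)).prod (volume.restrict (Metric.ball (0 : ℂ) 1))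

instance : IsFiniteMeasure bidiscMeasure := by unfold bidiscMeasure; infer_instance

theorem lintegral_hartogsTriangle {f : ℂ × ℂ → ℝ≥0∞} (hf : Measurable f) :
    ∫⁻ z in hartogsTriangle, f z = ∫⁻ p, ‖p.2‖ₑ ^ 2 * f (hartogsMap p) ∂bidiscMeasure := by
  have hm : Measurable (hartogsTriangle.indicator f) := hf.indicator measurableSet_hartogsTriangle
  have hm' : Measurable fun p : ℂ × ℂ => ‖p.2‖ₑ ^ 2 * f (hartogsMap p) :=
    (by fun_prop : Measurable fun p : ℂ × ℂ => ‖p.2‖ₑ ^ 2).mul (hf.comp measurable_hartogsMap)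
  rw [← lintegral_indicator measurableSet_hartogsTriangle, Measure.volume_eq_prod,
    lintegral_prod_symm _ hm.aemeasurable, bidiscMeasure, lintegral_prod_symm _ hm'.aemeasurable,
    ← lintegral_indicator measurableSet_ball]
  refine lintegral_congr_ae ?_
  filter_upwards [Measure.ae_ne volume (0 : ℂ)] with v hv
  have hmv : Measurable fun u => hartogsTriangle.indicator f (u, v) :=
    hm.comp (measurable_id.prodMk measurable_const)
  have hv' : 0 < ‖v‖ := norm_pos_iff.2 hv
  classical
  rw [Complex.lintegral_comp_mul_right hv hmv, Set.indicator_apply]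
  split_ifs with h
  · have hfm : Measurable fun u => f (hartogsMap (u, v)) :=
      hf.comp (measurable_hartogsMap.comp (measurable_id.prodMk measurable_const))
    rw [lintegral_const_mul _ hfm, ← lintegral_indicator measurableSet_ball]
    congr 2
    ext u
    simp only [Set.indicator_apply, hartogsTriangle, Set.mem_ofPred_eq, mem_ball_zero_iff,
      norm_mul, hartogsMap]
    rw [mem_ball_zero_iff] at h
    have : ‖u‖ * ‖v‖ < ‖v‖ ↔ ‖u‖ < 1 := mul_lt_iff_lt_one_left hv'
    simp [this, h]
  · rw [mem_ball_zero_iff] at h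
    have : ∀ u, hartogsTriangle.indicator f (u * v, v) = 0 := fun u => by
      rw [Set.indicator_of_notMem]
      exact fun hu => h hu.2
    simp [this]

theorem volume_restrict_hartogsTriangle : volume.restrict hartogsTriangle =
    Measure.map hartogsMap (bidiscMeasure.withDensity fun p => ‖p.2‖ₑ ^ 2) := by
  ext s hs
  have hms : Measurable fun p => s.indicator (1 : ℂ × ℂ → ℝ≥0∞) (hartogsMap p) :=
    (measurable_one.indicator hs).comp measurable_hartogsMap
  rw [← lintegral_indicator_one hs, ← lintegral_indicator_one hs,
    lintegral_hartogsTriangle (measurable_one.indicator hs),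
    lintegral_map (measurable_one.indicator hs) measurable_hartogsMap,
    lintegral_withDensity_eq_lintegral_mul _ (by fun_prop) hms]
  rfl

theorem ae_bidisc : ∀ᵐ p ∂bidiscMeasure, ‖p.1‖ < 1 ∧ ‖p.2‖ < 1 ∧ p.2 ≠ 0 := by
  have h1 : ∀ᵐ u ∂(volume.restrict (Metric.ball (0 : ℂ) 1)), ‖u‖ < 1 := by
    filter_upwards [ae_restrict_mem measurableSet_ball] with u hu using mem_ball_zero_iff.1 hu
  have h2 : ∀ᵐ u ∂(volume.restrict (Metric.ball (0 : ℂ) 1)), u ≠ 0 := Measure.ae_ne _ 0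
  unfold bidiscMeasure
  filter_upwards [Measure.quasiMeasurePreserving_fst.ae h1,
    Measure.quasiMeasurePreserving_snd.ae (h1.and h2)] with p hp hq using ⟨hp, hq⟩

/-- The exceptional set is enlarged to a measurable null set `N` and pulled back along the inverse
map `Ψ`, which is measurable; no measurability of `P` is needed. -/
theorem ae_hartogs_of_ae_bidisc {P : ℂ × ℂ → Prop}
    (h : ∀ᵐ p ∂bidiscMeasure, P (hartogsMap p)) :
    ∀ᵐ z ∂(volume.restrict hartogsTriangle), P z := by
  set Ψ : ℂ × ℂ → ℂ × ℂ := fun z => (z.1 / z.2, z.2) with hΨ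
  have hΨm : Measurable Ψ := by fun_prop
  obtain ⟨N, hN, hNm, hN0⟩ := exists_measurable_superset_of_null (ae_iff.1 h)
  have h1 : ∀ᵐ z ∂(volume.restrict hartogsTriangle), Ψ z ∉ N := by
    rw [volume_restrict_hartogsTriangle, ae_map_iff (p := fun z => Ψ z ∉ N)
      measurable_hartogsMap.aemeasurable (hΨm hNm.compl)]
    refine withDensity_absolutelyContinuous _ _ ?_
    filter_upwards [ae_bidisc, measure_eq_zero_iff_ae_notMem.1 hN0] with p hp hpN
    have : Ψ (hartogsMap p) = p := by
      ext <;> simp [hΨ, hartogsMap, hp.2.2]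
    rwa [this]
  filter_upwards [h1, ae_restrict_mem measurableSet_hartogsTriangle] with z hz hzH
  have h2 : P (hartogsMap (Ψ z)) := by
    by_contra hc
    exact hz (hN hc)
  have hz2 : z.2 ≠ 0 := norm_pos_iff.1 ((norm_nonneg _).trans_lt hzH.1)
  have h3 : hartogsMap (Ψ z) = z := by
    ext <;> simp [hΨ, hartogsMap, hz2]
  rwa [h3] at h2

theorem integral_hartogsTriangle {E : Type*} [NormedAddCommGroup E] [NormedSpace ℝ E]
    {f : ℂ × ℂ → E}
    (hf : AEStronglyMeasurable f (volume.restrict hartogsTriangle)) :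
    ∫ z in hartogsTriangle, f z = ∫ p, (‖p.2‖ ^ 2 : ℝ) • f (hartogsMap p) ∂bidiscMeasure := by
  have hd : (fun p : ℂ × ℂ => ‖p.2‖ₑ ^ 2) = fun p => ((‖p.2‖₊ ^ 2 : ℝ≥0) : ℝ≥0∞) := by
    ext p; simp [enorm_eq_nnnorm]
  rw [volume_restrict_hartogsTriangle] at hf ⊢
  rw [integral_map measurable_hartogsMap.aemeasurable hf, hd,
    integral_withDensity_eq_integral_smul (by fun_prop)]
  simp [NNReal.smul_def]

theorem integrable_hartogsTriangle_iff {E : Type*} [NormedAddCommGroup E] [NormedSpace ℝ E]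
    {f : ℂ × ℂ → E}
    (hf : AEStronglyMeasurable f (volume.restrict hartogsTriangle)) :
    IntegrableOn f hartogsTriangle ↔
      Integrable (fun p => (‖p.2‖ ^ 2 : ℝ) • f (hartogsMap p)) bidiscMeasure := by
  have hd : (fun p : ℂ × ℂ => ‖p.2‖ₑ ^ 2) = fun p => ((‖p.2‖₊ ^ 2 : ℝ≥0) : ℝ≥0∞) := by
    ext p; simp [enorm_eq_nnnorm]
  rw [IntegrableOn]
  rw [volume_restrict_hartogsTriangle] at hf ⊢
  rw [integrable_map_measure hf measurable_hartogsMap.aemeasurable, hd,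
    integrable_withDensity_iff_integrable_smul (by fun_prop)]
  simp [NNReal.smul_def]

/-! ### Schur's test and the weighted bound on the bidisc. -/

/-- **Schur's test**, with a weight. -/
theorem lintegral_rpow_le_of_schur {X : Type*} [MeasurableSpace X] {μ : Measure X} [SFinite μ]
    {k : X → X → ℝ≥0∞} (hk : Measurable (Function.uncurry k)) {p : ℝ} (hp : 1 < p)
    {φ ψ w f : X → ℝ≥0∞} (hφ : Measurable φ) (hψ : Measurable ψ) (hw : Measurable w)
    (hf : Measurable f) (hφ0 : ∀ᵐ x ∂μ, φ x ≠ 0) (hφt : ∀ᵐ x ∂μ, φ x ≠ ∞) {A B : ℝ≥0∞}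
    (h1 : ∀ᵐ x ∂μ, ∫⁻ y, k x y * φ y ∂μ ≤ A * ψ x)
    (h2 : ∀ᵐ y ∂μ, ∫⁻ x, k x y * (ψ x ^ (p - 1) * w x) ∂μ ≤ B * (φ y ^ (p - 1) * w y)) :
    ∫⁻ x, (∫⁻ y, k x y * f y ∂μ) ^ p * w x ∂μ ≤ A ^ (p - 1) * B * ∫⁻ x, f x ^ p * w x ∂μ := by
  have hp0 : 0 < p := by linarith
  have hp1 : 0 < p - 1 := by linarith
  have hpq : (p / (p - 1)).HolderConjugate p := (Real.HolderConjugate.conjExponent hp).symm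
  have hkx : ∀ x, Measurable (k x) := fun x => hk.comp (measurable_const.prodMk measurable_id)
  have hky : ∀ y, Measurable (fun x => k x y) := fun y =>
    hk.comp (measurable_id.prodMk measurable_const)
  have hfφ : Measurable fun y => f y ^ p * φ y ^ (1 - p) := (hf.pow_const _).mul (hφ.pow_const _)
  have hfw : Measurable fun y => f y ^ p * w y := (hf.pow_const _).mul hw
  have hψw : Measurable fun y => ψ y ^ (p - 1) * w y := (hψ.pow_const _).mul hw
  have hkf : ∀ x, Measurable fun y => k x y * (f y ^ p * φ y ^ (1 - p)) := fun x => (hkx x).mul hfφ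
  -- Hölder's inequality for the splitting `k f = (k φ)^((p-1)/p) · (k f^p φ^(1-p))^(1/p)`, followed
  -- by `h1`. Tonelli and `h2` then do the rest.
  have step1 : ∀ᵐ x ∂μ, (∫⁻ y, k x y * f y ∂μ) ^ p ≤
      (A * ψ x) ^ (p - 1) * ∫⁻ y, k x y * (f y ^ p * φ y ^ (1 - p)) ∂μ := by
    filter_upwards [h1] with x hx
    have hF : Measurable fun y => (k x y * φ y) ^ ((p - 1) / p) :=
      ((hkx x).mul hφ).pow_const _
    have hG : Measurable fun y => (k x y * (f y ^ p * φ y ^ (1 - p))) ^ (1 / p) :=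
      (hkf x).pow_const _
    have hpoint : ∫⁻ y, k x y * f y ∂μ = ∫⁻ y, ((fun y => (k x y * φ y) ^ ((p - 1) / p)) *
        fun y => (k x y * (f y ^ p * φ y ^ (1 - p))) ^ (1 / p)) y ∂μ := by
      refine lintegral_congr_ae ?_
      filter_upwards [hφ0, hφt] with y hy0 hyt
      simp only [Pi.mul_apply]
      rw [ENNReal.mul_rpow_of_nonneg _ _ (by positivity),
        ENNReal.mul_rpow_of_nonneg _ _ (by positivity),
        ENNReal.mul_rpow_of_nonneg _ _ (by positivity), ← ENNReal.rpow_mul, ← ENNReal.rpow_mul,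
        mul_one_div_cancel hp0.ne', ENNReal.rpow_one]
      calc k x y * f y = k x y ^ ((p - 1) / p + 1 / p) * φ y ^ ((p - 1) / p + (1 - p) * (1 / p))
            * f y := by
            rw [show (p - 1) / p + 1 / p = 1 by field_simp; ring,
              show (p - 1) / p + (1 - p) * (1 / p) = 0 by field_simp; ring]
            simp
        _ = _ := by
            rw [ENNReal.rpow_add_of_nonneg _ _ (by positivity) (by positivity),
              ENNReal.rpow_add _ _ hy0 hyt]
            ring
    have hH := ENNReal.lintegral_mul_le_Lp_mul_Lq μ hpq hF.aemeasurable hG.aemeasurable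
    rw [← hpoint] at hH
    have e1 : (p - 1) / p * (p / (p - 1)) = 1 := by field_simp
    have e2 : 1 / p * p = 1 := by field_simp
    simp only [← ENNReal.rpow_mul, e1, e2, ENNReal.rpow_one] at hH
    calc (∫⁻ y, k x y * f y ∂μ) ^ p ≤ _ := ENNReal.rpow_le_rpow hH hp0.le
      _ = (∫⁻ y, k x y * φ y ∂μ) ^ (p - 1) * ∫⁻ y, k x y * (f y ^ p * φ y ^ (1 - p)) ∂μ := by
          rw [ENNReal.mul_rpow_of_nonneg _ _ hp0.le, ← ENNReal.rpow_mul, ← ENNReal.rpow_mul, e2,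
            ENNReal.rpow_one, show 1 / (p / (p - 1)) * p = p - 1 by field_simp]
      _ ≤ _ := by gcongr
  have hmeas : Measurable fun z : X × X =>
      ψ z.1 ^ (p - 1) * w z.1 * (k z.1 z.2 * (f z.2 ^ p * φ z.2 ^ (1 - p))) :=
    (((hψ.comp measurable_fst).pow_const _).mul (hw.comp measurable_fst)).mul
      (hk.mul (((hf.comp measurable_snd).pow_const _).mul ((hφ.comp measurable_snd).pow_const _)))
  calc ∫⁻ x, (∫⁻ y, k x y * f y ∂μ) ^ p * w x ∂μ
      ≤ ∫⁻ x, A ^ (p - 1) * ∫⁻ y, ψ x ^ (p - 1) * w x *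
          (k x y * (f y ^ p * φ y ^ (1 - p))) ∂μ ∂μ := by
        refine lintegral_mono_ae ?_
        filter_upwards [step1] with x hx
        rw [lintegral_const_mul _ (hkf x)]
        calc _ ≤ (A * ψ x) ^ (p - 1) * (∫⁻ y, k x y * (f y ^ p * φ y ^ (1 - p)) ∂μ) * w x := by
              gcongr
          _ = _ := by
              rw [ENNReal.mul_rpow_of_nonneg _ _ hp1.le]
              ring
    _ = A ^ (p - 1) * ∫⁻ y, ∫⁻ x, ψ x ^ (p - 1) * w x *
          (k x y * (f y ^ p * φ y ^ (1 - p))) ∂μ ∂μ := by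
        rw [lintegral_const_mul _ hmeas.lintegral_prod_right', lintegral_lintegral_swap
          hmeas.aemeasurable]
    _ ≤ A ^ (p - 1) * ∫⁻ y, B * (f y ^ p * w y) ∂μ := by
        refine mul_le_mul' le_rfl (lintegral_mono_ae ?_)
        filter_upwards [h2, hφ0, hφt] with y hy hy0 hyt
        calc ∫⁻ x, ψ x ^ (p - 1) * w x * (k x y * (f y ^ p * φ y ^ (1 - p))) ∂μ
            = ∫⁻ x, (f y ^ p * φ y ^ (1 - p)) * (k x y * (ψ x ^ (p - 1) * w x)) ∂μ := by
              refine lintegral_congr fun x => ?_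
              ring
          _ = (f y ^ p * φ y ^ (1 - p)) * ∫⁻ x, k x y * (ψ x ^ (p - 1) * w x) ∂μ :=
              lintegral_const_mul _ ((hky y).mul hψw)
          _ ≤ (f y ^ p * φ y ^ (1 - p)) * (B * (φ y ^ (p - 1) * w y)) := by gcongr
          _ = φ y ^ ((1 - p) + (p - 1)) * (B * (f y ^ p * w y)) := by
              rw [ENNReal.rpow_add _ _ hy0 hyt]
              ring
          _ = _ := by simp
    _ = _ := by
        rw [lintegral_const_mul _ hfw, mul_assoc]

theorem norm_diskKernel_comm (v t : ℂ) : ‖diskKernel v t‖ = ‖diskKernel t v‖ := by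
  rw [diskKernel, diskKernel, norm_inv, norm_inv, norm_pow, norm_pow]
  rw [← RCLike.norm_conj (1 - v * conj t)]
  simp [mul_comm]

theorem lintegral_bidisc_kernel_le {c d : ℝ} (h0 : 0 < c) (h1 : c < 1) (hd : -2 < d) :
    ∃ C : ℝ≥0, ∀ p : ℂ × ℂ, ‖p.1‖ < 1 → ‖p.2‖ < 1 →
      ∫⁻ q, ‖diskKernel p.1 q.1‖ₑ * ‖diskKernel p.2 q.2‖ₑ *
        ENNReal.ofReal ((1 - ‖q.1‖ ^ 2) ^ (-c) * (1 - ‖q.2‖ ^ 2) ^ (-c) * ‖q.2‖ ^ d)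
          ∂bidiscMeasure ≤
      C * ENNReal.ofReal ((1 - ‖p.1‖ ^ 2) ^ (-c) * (1 - ‖p.2‖ ^ 2) ^ (-c)) := by
  obtain ⟨C₁, H₁⟩ := lintegral_diskKernel_le h0 h1 (d := 0) (by norm_num)
  obtain ⟨C₂, H₂⟩ := lintegral_diskKernel_le h0 h1 hd
  refine ⟨C₁ * C₂, fun p hp1 hp2 => ?_⟩
  have hm : ∀ (d : ℝ) (v : ℂ), Measurable fun t : ℂ =>
      ‖diskKernel v t‖ₑ * ENNReal.ofReal ((1 - ‖t‖ ^ 2) ^ (-c) * ‖t‖ ^ d) := fun d v =>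
    (measurable_diskKernel_comp measurable_const measurable_id).enorm.mul (by fun_prop)
  calc _ = ∫⁻ q, (‖diskKernel p.1 q.1‖ₑ *
          ENNReal.ofReal ((1 - ‖q.1‖ ^ 2) ^ (-c) * ‖q.1‖ ^ (0 : ℝ))) *
          (‖diskKernel p.2 q.2‖ₑ * ENNReal.ofReal ((1 - ‖q.2‖ ^ 2) ^ (-c) * ‖q.2‖ ^ d))
          ∂bidiscMeasure := by
        refine lintegral_congr_ae ?_
        filter_upwards [ae_bidisc] with q hq
        have : 0 < 1 - ‖q.1‖ ^ 2 := by nlinarith [norm_nonneg q.1]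
        rw [mul_assoc ((1 - ‖q.1‖ ^ 2) ^ (-c)), ENNReal.ofReal_mul (by positivity), Real.rpow_zero,
          mul_one]
        ring
    _ = _ := lintegral_prod_mul (hm _ _).aemeasurable (hm _ _).aemeasurable
    _ ≤ (C₁ * ENNReal.ofReal ((1 - ‖p.1‖ ^ 2) ^ (-c))) *
          (C₂ * ENNReal.ofReal ((1 - ‖p.2‖ ^ 2) ^ (-c))) :=
        mul_le_mul' (H₁ _ hp1) (H₂ _ hp2)
    _ = _ := by
        have : 0 < 1 - ‖p.1‖ ^ 2 := by nlinarith [norm_nonneg p.1]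
        rw [ENNReal.ofReal_mul (by positivity), ENNReal.coe_mul]
        ring

/-- The weighted `L^p` bound for the positive operator that dominates the Bergman projection of
the Hartogs triangle, in the coordinates of the bidisc. -/
theorem exists_lintegral_bidisc_rpow_le {p ε : ℝ} (hp : 1 < p) (hp3 : p < 3) (h1 : 4 - 3 * p < ε)
    (h2 : ε < 4 - p) :
    ∃ C : ℝ≥0, ∀ f : ℂ × ℂ → ℝ≥0∞, Measurable f →
      ∫⁻ x, (∫⁻ y, ‖diskKernel x.1 y.1‖ₑ * ‖diskKernel x.2 y.2‖ₑ *
          ENNReal.ofReal (‖x.2‖⁻¹ * ‖y.2‖) * f y ∂bidiscMeasure) ^ p *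
          ENNReal.ofReal (‖x.2‖ ^ (2 - ε)) ∂bidiscMeasure ≤
        C * ∫⁻ x, f x ^ p * ENNReal.ofReal (‖x.2‖ ^ (2 - ε)) ∂bidiscMeasure := by
  -- `β` makes the powers of `‖y.2‖` agree in the second Schur condition: `-β (p - 1) + (2 - ε) =
  -- 1`. The first condition needs `1 - β > -2`, which is `4 - 3p < ε`.
  set β : ℝ := (1 - ε) / (p - 1) with hβ
  have hp1 : 0 < p - 1 := by linarith
  have hβ3 : β < 3 := by rw [hβ, div_lt_iff₀ hp1]; linarith
  have hβp : β * (p - 1) = 1 - ε := by rw [hβ]; field_simp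
  obtain ⟨A, hA⟩ := lintegral_bidisc_kernel_le (c := 1 / 2) (d := 1 - β) (by norm_num)
    (by norm_num) (by linarith)
  -- The second condition integrates `ψ ^ (p - 1)`, which halves `p - 1` in the boundary exponent:
  -- it is below `1` because `p < 3`. The power `2 - p - ε` collects `-1` from the kernel, `1 - p`
  -- from `ψ` and `2 - ε` from the weight; it exceeds `-2` because `ε < 4 - p`.
  obtain ⟨B, hB⟩ := lintegral_bidisc_kernel_le (c := (p - 1) / 2) (d := 2 - p - ε) (by linarith)
    (by linarith) (by linarith)
  refine ⟨A ^ (p - 1) * B, fun f hf => ?_⟩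
  rw [ENNReal.coe_mul, ENNReal.coe_rpow_of_nonneg _ hp1.le]
  have hk : Measurable (Function.uncurry fun x y : ℂ × ℂ => ‖diskKernel x.1 y.1‖ₑ *
      ‖diskKernel x.2 y.2‖ₑ * ENNReal.ofReal (‖x.2‖⁻¹ * ‖y.2‖)) := by
    have m1 : Measurable fun z : (ℂ × ℂ) × (ℂ × ℂ) => diskKernel z.1.1 z.2.1 :=
      measurable_diskKernel_comp (by fun_prop) (by fun_prop)
    have m2 : Measurable fun z : (ℂ × ℂ) × (ℂ × ℂ) => diskKernel z.1.2 z.2.2 :=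
      measurable_diskKernel_comp (by fun_prop) (by fun_prop)
    exact (m1.enorm.mul m2.enorm).mul (by fun_prop)
  refine lintegral_rpow_le_of_schur (μ := bidiscMeasure) (k := fun x y : ℂ × ℂ =>
      ‖diskKernel x.1 y.1‖ₑ * ‖diskKernel x.2 y.2‖ₑ * ENNReal.ofReal (‖x.2‖⁻¹ * ‖y.2‖)) hk hp
    (w := fun x => ENNReal.ofReal (‖x.2‖ ^ (2 - ε))) (f := f) (A := A) (B := B)
    (φ := fun q => ENNReal.ofReal ((1 - ‖q.1‖ ^ 2) ^ (-(1 / 2) : ℝ) *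
      (1 - ‖q.2‖ ^ 2) ^ (-(1 / 2) : ℝ) * ‖q.2‖ ^ (-β)))
    (ψ := fun q => ENNReal.ofReal ((1 - ‖q.1‖ ^ 2) ^ (-(1 / 2) : ℝ) *
      (1 - ‖q.2‖ ^ 2) ^ (-(1 / 2) : ℝ) * ‖q.2‖⁻¹))
    (by fun_prop) (by fun_prop) (by fun_prop) hf ?_ ?_ ?_ ?_
  · filter_upwards [ae_bidisc] with q hq
    have e1 : 0 < 1 - ‖q.1‖ ^ 2 := by nlinarith [norm_nonneg q.1]
    have e2 : 0 < 1 - ‖q.2‖ ^ 2 := by nlinarith [norm_nonneg q.2]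
    have e3 : 0 < ‖q.2‖ := norm_pos_iff.2 hq.2.2
    exact (ENNReal.ofReal_pos.2 (by positivity)).ne'
  · exact Filter.Eventually.of_forall fun q => ENNReal.ofReal_ne_top
  · filter_upwards [ae_bidisc] with x hx
    have e1 : 0 < 1 - ‖x.1‖ ^ 2 := by nlinarith [norm_nonneg x.1]
    have e2 : 0 < 1 - ‖x.2‖ ^ 2 := by nlinarith [norm_nonneg x.2]
    calc _ = ∫⁻ y, ENNReal.ofReal ‖x.2‖⁻¹ * (‖diskKernel x.1 y.1‖ₑ * ‖diskKernel x.2 y.2‖ₑ *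
          ENNReal.ofReal ((1 - ‖y.1‖ ^ 2) ^ (-(1 / 2) : ℝ) * (1 - ‖y.2‖ ^ 2) ^ (-(1 / 2) : ℝ) *
          ‖y.2‖ ^ (1 - β))) ∂bidiscMeasure := by
          refine lintegral_congr_ae ?_
          filter_upwards [ae_bidisc] with y hy
          have e3 : 0 < ‖y.2‖ := norm_pos_iff.2 hy.2.2
          have e1 : 0 < 1 - ‖y.1‖ ^ 2 := by nlinarith [norm_nonneg y.1]
          have e2 : 0 < 1 - ‖y.2‖ ^ 2 := by nlinarith [norm_nonneg y.2]
          rw [sub_eq_add_neg 1 β, Real.rpow_add e3, Real.rpow_one,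
            ENNReal.ofReal_mul (by positivity), mul_left_comm (_ * _) ‖y.2‖,
            ENNReal.ofReal_mul (norm_nonneg y.2)]
          ring
      _ ≤ ENNReal.ofReal ‖x.2‖⁻¹ * (A * ENNReal.ofReal ((1 - ‖x.1‖ ^ 2) ^ (-(1 / 2) : ℝ) *
          (1 - ‖x.2‖ ^ 2) ^ (-(1 / 2) : ℝ))) := by
          rw [lintegral_const_mul' _ _ ENNReal.ofReal_ne_top]
          gcongr
          exact hA x hx.1 hx.2.1
      _ = _ := by
          rw [ENNReal.ofReal_mul (p := _ * _) (by positivity)]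
          ring
  · filter_upwards [ae_bidisc] with y hy
    have e1 : 0 < 1 - ‖y.1‖ ^ 2 := by nlinarith [norm_nonneg y.1]
    have e2 : 0 < 1 - ‖y.2‖ ^ 2 := by nlinarith [norm_nonneg y.2]
    have e3 : 0 < ‖y.2‖ := norm_pos_iff.2 hy.2.2
    have hsplit : ∀ {a b t : ℝ}, 0 < a → 0 < b → 0 < t → ∀ s : ℝ,
        (ENNReal.ofReal (a ^ (-(1 / 2) : ℝ) * b ^ (-(1 / 2) : ℝ) * t ^ s)) ^ (p - 1) *
          ENNReal.ofReal (t ^ (2 - ε)) =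
        ENNReal.ofReal (a ^ (-((p - 1) / 2)) * b ^ (-((p - 1) / 2)) *
          t ^ (s * (p - 1) + (2 - ε))) := by
      intro a b t ha hb ht s
      rw [ENNReal.ofReal_rpow_of_pos (by positivity), ← ENNReal.ofReal_mul (by positivity),
        Real.mul_rpow (by positivity) (by positivity), Real.mul_rpow (by positivity) (by positivity),
        ← Real.rpow_mul ha.le, ← Real.rpow_mul hb.le, ← Real.rpow_mul ht.le, mul_assoc,
        ← Real.rpow_add ht, show -(1 / 2) * (p - 1) = -((p - 1) / 2) by ring]
    calc _ = ∫⁻ x, ENNReal.ofReal ‖y.2‖ * (‖diskKernel y.1 x.1‖ₑ * ‖diskKernel y.2 x.2‖ₑ *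
          ENNReal.ofReal ((1 - ‖x.1‖ ^ 2) ^ (-((p - 1) / 2)) * (1 - ‖x.2‖ ^ 2) ^ (-((p - 1) / 2)) *
          ‖x.2‖ ^ (2 - p - ε))) ∂bidiscMeasure := by
          refine lintegral_congr_ae ?_
          filter_upwards [ae_bidisc] with x hx
          have e3 : 0 < ‖x.2‖ := norm_pos_iff.2 hx.2.2
          have e1 : 0 < 1 - ‖x.1‖ ^ 2 := by nlinarith [norm_nonneg x.1]
          have e2 : 0 < 1 - ‖x.2‖ ^ 2 := by nlinarith [norm_nonneg x.2]
          rw [← Real.rpow_neg_one ‖x.2‖, hsplit e1 e2 e3,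
            show 2 - p - ε = -1 + (-1 * (p - 1) + (2 - ε)) by ring, Real.rpow_add e3 (-1),
            ENNReal.ofReal_mul (by positivity), mul_left_comm (_ * _) (‖x.2‖ ^ (-1 : ℝ)),
            ENNReal.ofReal_mul (p := ‖x.2‖ ^ (-1 : ℝ)) (by positivity), ← ofReal_norm, ← ofReal_norm,
            ← ofReal_norm, ← ofReal_norm, norm_diskKernel_comm x.1, norm_diskKernel_comm x.2]
          ring
      _ ≤ ENNReal.ofReal ‖y.2‖ * (B * ENNReal.ofReal ((1 - ‖y.1‖ ^ 2) ^ (-((p - 1) / 2)) *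
          (1 - ‖y.2‖ ^ 2) ^ (-((p - 1) / 2)))) := by
          rw [lintegral_const_mul' _ _ ENNReal.ofReal_ne_top]
          gcongr
          exact hB y hy.1 hy.2.1
      _ = _ := by
          rw [hsplit e1 e2 e3, neg_mul, hβp, show -(1 - ε) + (2 - ε) = 1 by ring, Real.rpow_one,
            ENNReal.ofReal_mul (p := _ * _) (by positivity)]
          ring

/-! ### The explicit kernel and its operator on weighted spaces. -/

/-- The explicit formula for the Bergman kernel of the Hartogs triangle. -/
noncomputable def hartogsKernel (z w : ℂ × ℂ) : ℂ :=
  ((Real.pi : ℂ) ^ 2)⁻¹ * (z.2 * conj w.2)⁻¹ * diskKernel (z.1 / z.2) (w.1 / w.2) *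
    diskKernel z.2 w.2

theorem measurable_hartogsKernel_comp {X : Type*} [MeasurableSpace X] {f g : X → ℂ × ℂ}
    (hf : Measurable f) (hg : Measurable g) : Measurable fun x => hartogsKernel (f x) (g x) := by
  unfold hartogsKernel
  have hc : Measurable fun t : ℂ => conj t := Complex.continuous_conj.measurable
  have h1 : Measurable fun x => diskKernel ((f x).1 / (f x).2) ((g x).1 / (g x).2) :=
    measurable_diskKernel_comp (by fun_prop) (by fun_prop)
  have h2 : Measurable fun x => diskKernel (f x).2 (g x).2 :=
    measurable_diskKernel_comp (by fun_prop) (by fun_prop)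
  fun_prop

theorem conj_diskKernel (v t : ℂ) : conj (diskKernel v t) = diskKernel t v := by
  simp [diskKernel, mul_comm]

theorem conj_hartogsKernel (z w : ℂ × ℂ) : conj (hartogsKernel z w) = hartogsKernel w z := by
  simp only [hartogsKernel, map_mul, map_inv₀, map_pow, conj_diskKernel, Complex.conj_conj,
    Complex.conj_ofReal]
  rw [mul_comm (conj z.2)]

theorem hartogsKernel_hartogsMap {p q : ℂ × ℂ} (hp : p.2 ≠ 0) (hq : q.2 ≠ 0) :
    hartogsKernel (hartogsMap p) (hartogsMap q) =
      ((Real.pi : ℂ) ^ 2)⁻¹ * (p.2 * conj q.2)⁻¹ * diskKernel p.1 q.1 * diskKernel p.2 q.2 := by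
  simp [hartogsKernel, hartogsMap, hp, hq]

theorem snd_ne_zero_of_mem_hartogsTriangle {z : ℂ × ℂ} (hz : z ∈ hartogsTriangle) : z.2 ≠ 0 :=
  norm_pos_iff.1 ((norm_nonneg _).trans_lt hz.1)

theorem norm_div_lt_one_of_mem_hartogsTriangle {z : ℂ × ℂ} (hz : z ∈ hartogsTriangle) :
    ‖z.1 / z.2‖ < 1 := by
  rw [norm_div]
  exact (div_lt_one ((norm_nonneg _).trans_lt hz.1)).2 hz.1

/-- For fixed `z` the only singularity in `w` is `‖w.2‖⁻¹`. Hence integrability of `‖w.2‖⁻¹ * ‖f w‖`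
suffices for the operator to be defined at every point. -/
theorem norm_hartogsKernel_le {z w : ℂ × ℂ} (hz : z ∈ hartogsTriangle)
    (hw : w ∈ hartogsTriangle) :
    ‖hartogsKernel z w‖ ≤ ((Real.pi ^ 2)⁻¹ * ‖z.2‖⁻¹ * ((1 - ‖z.1 / z.2‖) ^ 2)⁻¹ *
      ((1 - ‖z.2‖) ^ 2)⁻¹) * ‖w.2‖⁻¹ := by
  have h1 := norm_diskKernel_le (norm_div_lt_one_of_mem_hartogsTriangle hz)
    (norm_div_lt_one_of_mem_hartogsTriangle hw).le
  have h2 := norm_diskKernel_le hz.2 hw.2.le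
  have h3 : ‖hartogsKernel z w‖ = ((Real.pi ^ 2)⁻¹ * ‖z.2‖⁻¹ * ‖w.2‖⁻¹) *
      ‖diskKernel (z.1 / z.2) (w.1 / w.2)‖ * ‖diskKernel z.2 w.2‖ := by
    simp only [hartogsKernel, norm_mul, norm_inv, norm_pow, RCLike.norm_conj, Complex.norm_real,
      Real.norm_of_nonneg Real.pi_pos.le, mul_inv]
    ring
  rw [h3]
  calc _ ≤ ((Real.pi ^ 2)⁻¹ * ‖z.2‖⁻¹ * ‖w.2‖⁻¹) * ((1 - ‖z.1 / z.2‖) ^ 2)⁻¹ *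
        ((1 - ‖z.2‖) ^ 2)⁻¹ := by gcongr
    _ = _ := by ring

/-- The Jacobian `‖q.2‖ ^ 2` turns the factor `‖q.2‖⁻¹` of the kernel into `‖q.2‖`; the constant
`π⁻²` is dropped. -/
theorem enorm_hartogsKernel_hartogsMap_le {p q : ℂ × ℂ} (hp : p.2 ≠ 0) (hq : q.2 ≠ 0) :
    ‖q.2‖ₑ ^ 2 * ‖hartogsKernel (hartogsMap p) (hartogsMap q)‖ₑ ≤
      ‖diskKernel p.1 q.1‖ₑ * ‖diskKernel p.2 q.2‖ₑ * ENNReal.ofReal (‖p.2‖⁻¹ * ‖q.2‖) := by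
  rw [hartogsKernel_hartogsMap hp hq]
  simp only [← ofReal_norm]
  rw [← ENNReal.ofReal_mul (norm_nonneg _), ← ENNReal.ofReal_mul (by positivity),
    ← ENNReal.ofReal_pow (norm_nonneg _), ← ENNReal.ofReal_mul (by positivity)]
  refine ENNReal.ofReal_le_ofReal ?_
  have hq' : ‖q.2‖ ≠ 0 := norm_ne_zero_iff.2 hq
  have hpi : (Real.pi ^ 2)⁻¹ ≤ 1 := inv_le_one_of_one_le₀ (by nlinarith [Real.pi_gt_three])
  simp only [norm_mul, norm_inv, norm_pow, RCLike.norm_conj, Complex.norm_real,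
      Real.norm_of_nonneg Real.pi_pos.le, mul_inv]
  calc _ = (Real.pi ^ 2)⁻¹ * (‖diskKernel p.1 q.1‖ * ‖diskKernel p.2 q.2‖ * (‖p.2‖⁻¹ * ‖q.2‖)) := by
        field_simp
    _ ≤ 1 * (‖diskKernel p.1 q.1‖ * ‖diskKernel p.2 q.2‖ * (‖p.2‖⁻¹ * ‖q.2‖)) := by
        gcongr
    _ = _ := one_mul _

theorem enorm_sq_mul_ofReal_rpow {v : ℂ} (hv : v ≠ 0) (s : ℝ) :
    ‖v‖ₑ ^ 2 * ENNReal.ofReal (‖v‖ ^ s) = ENNReal.ofReal (‖v‖ ^ (2 + s)) := by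
  rw [← ofReal_norm, ← ENNReal.ofReal_pow (norm_nonneg _), ← ENNReal.ofReal_mul (by positivity),
    Real.rpow_add (norm_pos_iff.2 hv), Real.rpow_two]

/-- The weighted `L^p` bound for the positive operator that dominates the Bergman projection of
the Hartogs triangle. -/
theorem exists_lintegral_hartogs_rpow_le {p ε : ℝ} (hp : 1 < p) (hp3 : p < 3) (h1 : 4 - 3 * p < ε)
    (h2 : ε < 4 - p) :
    ∃ C : ℝ≥0, ∀ f : ℂ × ℂ → ℝ≥0∞, AEMeasurable f (volume.restrict hartogsTriangle) →
      ∫⁻ z in hartogsTriangle, (∫⁻ w in hartogsTriangle, ‖hartogsKernel z w‖ₑ * f w) ^ p *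
          ENNReal.ofReal (‖z.2‖ ^ (-ε)) ≤
        C * ∫⁻ z in hartogsTriangle, f z ^ p * ENNReal.ofReal (‖z.2‖ ^ (-ε)) := by
  obtain ⟨C, hC⟩ := exists_lintegral_bidisc_rpow_le hp hp3 h1 h2
  have main : ∀ f : ℂ × ℂ → ℝ≥0∞, Measurable f →
      ∫⁻ z in hartogsTriangle, (∫⁻ w in hartogsTriangle, ‖hartogsKernel z w‖ₑ * f w) ^ p *
          ENNReal.ofReal (‖z.2‖ ^ (-ε)) ≤
        C * ∫⁻ z in hartogsTriangle, f z ^ p * ENNReal.ofReal (‖z.2‖ ^ (-ε)) := by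
    intro f hf
    have hk : Measurable fun x : (ℂ × ℂ) × (ℂ × ℂ) => ‖hartogsKernel x.1 x.2‖ₑ * f x.2 :=
      (measurable_hartogsKernel_comp measurable_fst measurable_snd).enorm.mul (hf.comp measurable_snd)
    have hk' : ∀ z, Measurable fun w => ‖hartogsKernel z w‖ₑ * f w := fun z =>
      (measurable_hartogsKernel_comp measurable_const measurable_id).enorm.mul hf
    have hT : Measurable fun z => ∫⁻ w in hartogsTriangle, ‖hartogsKernel z w‖ₑ * f w :=
      hk.lintegral_prod_right'
    have hwt : Measurable fun z : ℂ × ℂ => ENNReal.ofReal (‖z.2‖ ^ (-ε)) := by fun_prop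
    have hTw : Measurable fun z => (∫⁻ w in hartogsTriangle, ‖hartogsKernel z w‖ₑ * f w) ^ p *
        ENNReal.ofReal (‖z.2‖ ^ (-ε)) := (hT.pow_const _).mul hwt
    have hfw : Measurable fun z => f z ^ p * ENNReal.ofReal (‖z.2‖ ^ (-ε)) :=
      (hf.pow_const _).mul hwt
    rw [lintegral_hartogsTriangle hTw, lintegral_hartogsTriangle hfw]
    calc _ ≤ ∫⁻ x, (∫⁻ y, ‖diskKernel x.1 y.1‖ₑ * ‖diskKernel x.2 y.2‖ₑ *
          ENNReal.ofReal (‖x.2‖⁻¹ * ‖y.2‖) * f (hartogsMap y) ∂bidiscMeasure) ^ p *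
          ENNReal.ofReal (‖x.2‖ ^ (2 - ε)) ∂bidiscMeasure := by
          refine lintegral_mono_ae ?_
          filter_upwards [ae_bidisc] with x hx
          rw [mul_left_comm, show (hartogsMap x).2 = x.2 from rfl,
            enorm_sq_mul_ofReal_rpow hx.2.2, ← sub_eq_add_neg]
          refine mul_le_mul' (ENNReal.rpow_le_rpow ?_ (by linarith)) le_rfl
          rw [lintegral_hartogsTriangle (hk' _)]
          refine lintegral_mono_ae ?_
          filter_upwards [ae_bidisc] with y hy
          rw [← mul_assoc]
          exact mul_le_mul' (enorm_hartogsKernel_hartogsMap_le hx.2.2 hy.2.2) le_rfl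
      _ ≤ _ := hC (fun y => f (hartogsMap y)) (hf.comp measurable_hartogsMap)
      _ = _ := by
          congr 1
          refine lintegral_congr_ae ?_
          filter_upwards [ae_bidisc] with x hx
          rw [mul_left_comm, show (hartogsMap x).2 = x.2 from rfl,
            enorm_sq_mul_ofReal_rpow hx.2.2, ← sub_eq_add_neg]
  refine ⟨C, fun f hf => ?_⟩
  have h3 := main (hf.mk f) hf.measurable_mk
  have h4 := hf.ae_eq_mk
  have h5 : ∀ z, ∫⁻ w in hartogsTriangle, ‖hartogsKernel z w‖ₑ * f w =
      ∫⁻ w in hartogsTriangle, ‖hartogsKernel z w‖ₑ * hf.mk f w := fun z =>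
    lintegral_congr_ae (h4.mono fun w hw => by simp only [hw])
  have h6 : ∫⁻ z in hartogsTriangle, f z ^ p * ENNReal.ofReal (‖z.2‖ ^ (-ε)) =
      ∫⁻ z in hartogsTriangle, hf.mk f z ^ p * ENNReal.ofReal (‖z.2‖ ^ (-ε)) :=
    lintegral_congr_ae (h4.mono fun w hw => by simp only [hw])
  simp only [h5, h6]
  exact h3

theorem lintegral_hartogsMeasure (a : ℝ) (f : ℂ × ℂ → ℝ≥0∞) :
    ∫⁻ z, f z ∂(hartogsMeasure a) =
      ∫⁻ z in hartogsTriangle, f z * ENNReal.ofReal (‖z.2‖ ^ a) := by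
  rw [hartogsMeasure, lintegral_withDensity_eq_lintegral_mul_non_measurable _ (by fun_prop)
    (Filter.Eventually.of_forall fun _ => ENNReal.ofReal_lt_top)]
  simp only [Pi.mul_apply, mul_comm]

theorem hartogsMeasure_absolutelyContinuous (a : ℝ) :
    hartogsMeasure a ≪ volume.restrict hartogsTriangle :=
  withDensity_absolutelyContinuous _ _

theorem absolutelyContinuous_hartogsMeasure (a : ℝ) :
    volume.restrict hartogsTriangle ≪ hartogsMeasure a := by
  refine withDensity_absolutelyContinuous' (by fun_prop) ?_
  filter_upwards [ae_restrict_mem measurableSet_hartogsTriangle] with z hz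
  have := norm_pos_iff.2 (snd_ne_zero_of_mem_hartogsTriangle hz)
  exact (ENNReal.ofReal_pos.2 (by positivity)).ne'

theorem hartogsMeasure_zero : hartogsMeasure 0 = volume.restrict hartogsTriangle := by
  simp [hartogsMeasure]

theorem aestronglyMeasurable_kernelOperator {f : ℂ × ℂ → ℂ}
    (hf : AEStronglyMeasurable f (volume.restrict hartogsTriangle)) :
    AEStronglyMeasurable (kernelOperator hartogsTriangle hartogsKernel f)
      (volume.restrict hartogsTriangle) := by
  have h1 : AEStronglyMeasurable (fun x : (ℂ × ℂ) × (ℂ × ℂ) => hartogsKernel x.1 x.2 * f x.2)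
      ((volume.restrict hartogsTriangle).prod (volume.restrict hartogsTriangle)) :=
    (measurable_hartogsKernel_comp measurable_fst measurable_snd).aestronglyMeasurable.mul
      hf.comp_snd
  exact h1.integral_prod_right'

/-- The weighted `L^p` bound for the Bergman projection of the Hartogs triangle. -/
theorem exists_eLpNorm_kernelOperator_le {P : ℝ≥0∞} {ε : ℝ} (hPt : P ≠ ∞) (hp : 1 < P.toReal)
    (hp3 : P.toReal < 3) (h1 : 4 - 3 * P.toReal < ε) (h2 : ε < 4 - P.toReal) :
    ∃ C : ℝ≥0, ∀ f : ℂ × ℂ → ℂ, AEStronglyMeasurable f (volume.restrict hartogsTriangle) →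
      eLpNorm (kernelOperator hartogsTriangle hartogsKernel f) P (hartogsMeasure (-ε)) ≤
        C * eLpNorm f P (hartogsMeasure (-ε)) := by
  obtain ⟨C, hC⟩ := exists_lintegral_hartogs_rpow_le hp hp3 h1 h2
  have hP0 : P ≠ 0 := by rintro rfl; simp at hp; linarith
  refine ⟨C ^ (1 / P.toReal), fun f hf => ?_⟩
  rw [eLpNorm_eq_lintegral_rpow_enorm_toReal hP0 hPt,
    eLpNorm_eq_lintegral_rpow_enorm_toReal hP0 hPt, lintegral_hartogsMeasure,
    lintegral_hartogsMeasure, ENNReal.coe_rpow_of_nonneg _ (by positivity),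
    ← ENNReal.mul_rpow_of_nonneg _ _ (by positivity)]
  refine ENNReal.rpow_le_rpow (le_trans ?_ (hC (fun z => ‖f z‖ₑ) hf.enorm)) (by positivity)
  refine lintegral_mono fun z => ?_
  refine mul_le_mul' (ENNReal.rpow_le_rpow ?_ (by linarith)) le_rfl
  refine (enorm_integral_le_lintegral_enorm _).trans (le_of_eq ?_)
  simp only [enorm_mul]

/-- At the origin both disc kernels equal `1`, so the Forelli-Rudin bound there dominates the
integral; the Jacobian shifts the threshold from `-2` to `-4`. -/
theorem lintegral_hartogsTriangle_rpow_lt_top {d : ℝ} (hd : -4 < d) :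
    ∫⁻ z in hartogsTriangle, ENNReal.ofReal (‖z.2‖ ^ d) < ∞ := by
  obtain ⟨C, hC⟩ := lintegral_bidisc_kernel_le (c := 1 / 2) (d := 2 + d) (by norm_num)
    (by norm_num) (by linarith)
  have h := hC 0 (by simp) (by simp)
  rw [lintegral_hartogsTriangle (by fun_prop)]
  refine lt_of_le_of_lt (le_trans (lintegral_mono_ae ?_) h) (by finiteness)
  filter_upwards [ae_bidisc] with q hq
  have e1 : 0 < 1 - ‖q.1‖ ^ 2 := by nlinarith [norm_nonneg q.1]
  have e2 : 0 < 1 - ‖q.2‖ ^ 2 := by nlinarith [norm_nonneg q.2]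
  have e3 : 1 ≤ (1 - ‖q.1‖ ^ 2) ^ (-(1 / 2) : ℝ) :=
    Real.one_le_rpow_of_pos_of_le_one_of_nonpos e1 (by nlinarith [norm_nonneg q.1]) (by norm_num)
  have e4 : 1 ≤ (1 - ‖q.2‖ ^ 2) ^ (-(1 / 2) : ℝ) :=
    Real.one_le_rpow_of_pos_of_le_one_of_nonpos e2 (by nlinarith [norm_nonneg q.2]) (by norm_num)
  rw [show (hartogsMap q).2 = q.2 from rfl, enorm_sq_mul_ofReal_rpow hq.2.2]
  simp only [diskKernel, Prod.fst_zero, Prod.snd_zero, zero_mul, sub_zero, one_pow, inv_one,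
    enorm_one, one_mul]
  refine ENNReal.ofReal_le_ofReal ?_
  refine le_mul_of_one_le_left (by positivity) ?_
  exact one_le_mul_of_one_le_of_one_le e3 e4

/-- Hölder's inequality in the weighted measure, with `‖z.2‖⁻¹ = ‖z.2‖ ^ (ε - 1) * ‖z.2‖ ^ (-ε)`.
The conjugate power of `‖z.2‖ ^ (ε - 1)` is integrable when `(ε - 1) p / (p - 1) - ε > -4`, that is
`ε > 4 - 3p`. -/
theorem integrable_norm_inv_mul_of_memLp {P : ℝ≥0∞} {ε : ℝ} (hPt : P ≠ ∞) (hp : 1 < P.toReal)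
    (h1 : 4 - 3 * P.toReal < ε) {f : ℂ × ℂ → ℂ} (hf : MemLp f P (hartogsMeasure (-ε))) :
    IntegrableOn (fun z => ‖z.2‖⁻¹ * ‖f z‖) hartogsTriangle := by
  have hP0 : P ≠ 0 := by rintro rfl; simp at hp; linarith
  set p := P.toReal
  have hm : AEStronglyMeasurable f (volume.restrict hartogsTriangle) :=
    hf.1.mono_ac (absolutelyContinuous_hartogsMeasure _)
  have hp1 : 0 < p - 1 := by linarith
  have hpq : p.HolderConjugate (p / (p - 1)) := Real.HolderConjugate.conjExponent hp
  have hH := ENNReal.lintegral_mul_le_Lp_mul_Lq (hartogsMeasure (-ε)) hpq hf.1.enorm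
    (g := fun z => ENNReal.ofReal (‖z.2‖ ^ (ε - 1))) (by fun_prop)
  refine ⟨(by fun_prop : Measurable fun z : ℂ × ℂ => ‖z.2‖⁻¹).aestronglyMeasurable.mul hm.norm, ?_⟩
  have hfin : (∫⁻ z, ‖f z‖ₑ ^ p ∂hartogsMeasure (-ε)) < ∞ :=
    (lintegral_rpow_enorm_lt_top_of_eLpNorm_lt_top hP0 hPt hf.2)
  have hgin : (∫⁻ z, ENNReal.ofReal (‖z.2‖ ^ (ε - 1)) ^ (p / (p - 1)) ∂hartogsMeasure (-ε)) < ∞ := by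
    rw [lintegral_hartogsMeasure]
    refine lt_of_le_of_lt (le_of_eq ?_) (lintegral_hartogsTriangle_rpow_lt_top
      (d := (ε - 1) * (p / (p - 1)) + -ε) ?_)
    · refine setLIntegral_congr_fun measurableSet_hartogsTriangle fun z hz => ?_
      have := norm_pos_iff.2 (snd_ne_zero_of_mem_hartogsTriangle hz)
      rw [ENNReal.ofReal_rpow_of_pos (by positivity), ← ENNReal.ofReal_mul (by positivity),
        ← Real.rpow_mul this.le, ← Real.rpow_add this]
    · rw [← sub_pos]
      have : (ε - 1) * (p / (p - 1)) + -ε - -4 = (ε - (4 - 3 * p)) / (p - 1) := by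
        field_simp; ring
      rw [this]
      exact div_pos (by linarith) hp1
  refine lt_of_le_of_lt (le_trans (le_of_eq ?_) hH) ?_
  · rw [lintegral_hartogsMeasure]
    refine setLIntegral_congr_fun measurableSet_hartogsTriangle fun z hz => ?_
    have := norm_pos_iff.2 (snd_ne_zero_of_mem_hartogsTriangle hz)
    simp only [Pi.mul_apply]
    rw [enorm_mul, enorm_norm, mul_assoc, ← ENNReal.ofReal_mul (by positivity),
      ← Real.rpow_add this, show ε - 1 + -ε = -1 by ring, Real.rpow_neg_one, mul_comm,
      Real.enorm_of_nonneg (by positivity)]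
  · exact ENNReal.mul_lt_top (ENNReal.rpow_lt_top_of_nonneg (by positivity) hfin.ne)
      (ENNReal.rpow_lt_top_of_nonneg (by positivity) hgin.ne)

theorem integrableOn_hartogsKernel_mul {f : ℂ × ℂ → ℂ}
    (hm : AEStronglyMeasurable f (volume.restrict hartogsTriangle))
    (hf : IntegrableOn (fun z => ‖z.2‖⁻¹ * ‖f z‖) hartogsTriangle) {z : ℂ × ℂ}
    (hz : z ∈ hartogsTriangle) :
    IntegrableOn (fun w => hartogsKernel z w * f w) hartogsTriangle := by
  refine (hf.const_mul ((Real.pi ^ 2)⁻¹ * ‖z.2‖⁻¹ * ((1 - ‖z.1 / z.2‖) ^ 2)⁻¹ *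
      ((1 - ‖z.2‖) ^ 2)⁻¹)).mono' ((measurable_hartogsKernel_comp measurable_const
      measurable_id).aestronglyMeasurable.mul hm) ?_
  filter_upwards [ae_restrict_mem measurableSet_hartogsTriangle] with w hw
  rw [norm_mul, ← mul_assoc]
  exact mul_le_mul_of_nonneg_right (norm_hartogsKernel_le hz hw) (norm_nonneg _)

theorem memLp_hartogsKernel {z : ℂ × ℂ} (hz : z ∈ hartogsTriangle) :
    MemLp (hartogsKernel z) 2 (volume.restrict hartogsTriangle) := by
  have h1 : MemLp (fun w : ℂ × ℂ => ‖w.2‖⁻¹) 2 (volume.restrict hartogsTriangle) := by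
    have hm : Measurable fun w : ℂ × ℂ => ‖w.2‖⁻¹ := by fun_prop
    rw [memLp_two_iff_integrable_sq_norm hm.aestronglyMeasurable]
    refine ⟨by fun_prop, ?_⟩
    refine lt_of_le_of_lt (le_of_eq ?_) (lintegral_hartogsTriangle_rpow_lt_top (d := -2)
      (by norm_num))
    refine lintegral_congr fun z => ?_
    rw [Real.enorm_of_nonneg (by positivity), Real.rpow_neg (norm_nonneg _), Real.rpow_two]
    simp
  refine (h1.const_mul ((Real.pi ^ 2)⁻¹ * ‖z.2‖⁻¹ * ((1 - ‖z.1 / z.2‖) ^ 2)⁻¹ *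
      ((1 - ‖z.2‖) ^ 2)⁻¹)).mono' (measurable_hartogsKernel_comp measurable_const
      measurable_id).aestronglyMeasurable ?_
  filter_upwards [ae_restrict_mem measurableSet_hartogsTriangle] with w hw
    using norm_hartogsKernel_le hz hw

/-! ### The explicit kernel reproduces holomorphic functions. -/

theorem hartogsMap_mem {q : ℂ × ℂ} (h1 : ‖q.1‖ < 1) (h2 : ‖q.2‖ < 1) (h0 : q.2 ≠ 0) :
    hartogsMap q ∈ hartogsTriangle := by
  refine ⟨?_, h2⟩
  simp only [hartogsMap, norm_mul]
  exact mul_lt_of_lt_one_left (norm_pos_iff.2 h0) h1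

theorem aestronglyMeasurable_comp_hartogsMap {g : ℂ × ℂ → ℂ}
    (hg : ContinuousOn g hartogsTriangle) :
    AEStronglyMeasurable (fun q => g (hartogsMap q)) bidiscMeasure := by
  have h1 := (measurable_indicator_of_continuousOn measurableSet_hartogsTriangle hg).comp
    measurable_hartogsMap
  refine h1.aestronglyMeasurable.congr ?_
  filter_upwards [ae_bidisc] with q hq
  simp only [Function.comp_apply]
  rw [Set.indicator_of_mem (hartogsMap_mem hq.1 hq.2.1 hq.2.2)]

/-- The explicit kernel reproduces the square-integrable holomorphic functions on the Hartogs
triangle. -/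
theorem ae_kernelOperator_hartogsKernel_eq {g : ℂ × ℂ → ℂ}
    (hd : DifferentiableOn ℂ g hartogsTriangle)
    (hi : IntegrableOn (fun z => ‖g z‖ ^ 2) hartogsTriangle) :
    ∀ᵐ z ∂(volume.restrict hartogsTriangle),
      kernelOperator hartogsTriangle hartogsKernel g z = g z := by
  set D : Measure ℂ := volume.restrict (Metric.ball (0 : ℂ) 1) with hD
  have hbi : bidiscMeasure = D.prod D := rfl
  have hgm : AEStronglyMeasurable g (volume.restrict hartogsTriangle) :=
    hd.continuousOn.aestronglyMeasurable measurableSet_hartogsTriangle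
  -- The factor `q.2` is a holomorphic square root of the Jacobian, so `G` has the same `L²` norm on
  -- the bidisc as `g` on the triangle, and stays holomorphic in each variable.
  set G : ℂ × ℂ → ℂ := fun q => q.2 * g (hartogsMap q) with hG
  have hGm : AEStronglyMeasurable G bidiscMeasure :=
    measurable_snd.aestronglyMeasurable.mul (aestronglyMeasurable_comp_hartogsMap hd.continuousOn)
  have hGi : Integrable (fun q => ‖G q‖ ^ 2) bidiscMeasure := by
    have := (integrable_hartogsTriangle_iff (hgm.norm.pow 2)).1 hi
    refine this.congr (Filter.Eventually.of_forall fun q => ?_)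
    simp [hG, mul_pow]
  have hG1 : Integrable G bidiscMeasure := integrable_of_sq_integrable hGm hGi
  have hdt : ∀ s : ℂ, ‖s‖ < 1 →
      DifferentiableOn ℂ (fun t => G (s, t)) (Metric.ball 0 1 \ {0}) := fun s hs =>
    differentiableOn_id.fun_mul (hd.comp (f := fun t => hartogsMap (s, t))
      (by unfold hartogsMap; fun_prop)
      fun t ht => hartogsMap_mem (q := (s, t)) hs (mem_ball_zero_iff.1 ht.1) ht.2)
  have hds : ∀ t : ℂ, ‖t‖ < 1 → t ≠ 0 →
      DifferentiableOn ℂ (fun s => G (s, t)) (Metric.ball 0 1 \ {0}) := fun t ht ht0 =>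
    (differentiableOn_const t).fun_mul (hd.comp (f := fun s => hartogsMap (s, t))
      (by unfold hartogsMap; fun_prop)
      fun s hs => hartogsMap_mem (q := (s, t)) (mem_ball_zero_iff.1 hs.1) ht ht0)
  have hit : ∀ᵐ s ∂D, Integrable (fun t => ‖G (s, t)‖ ^ 2) D := hGi.prod_right_ae
  have his : ∀ᵐ t ∂D, Integrable (fun s => ‖G (s, t)‖ ^ 2) D := hGi.prod_left_ae
  have hDlt : ∀ᵐ s ∂D, ‖s‖ < 1 := by
    filter_upwards [ae_restrict_mem measurableSet_ball] with u hu using mem_ball_zero_iff.1 hu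
  have hD0 : ∀ᵐ s ∂D, s ≠ 0 := Measure.ae_ne _ 0
  refine ae_hartogs_of_ae_bidisc ?_
  -- The one-variable reproducing property is stated away from the centre, which costs only a null
  -- set of points.
  have e1 : ∀ᵐ p ∂bidiscMeasure, p.1 ≠ 0 := Measure.quasiMeasurePreserving_fst.ae hD0
  have e2 : ∀ᵐ p ∂bidiscMeasure, Integrable (fun s => ‖G (s, p.2)‖ ^ 2) D :=
    Measure.quasiMeasurePreserving_snd.ae his
  filter_upwards [ae_bidisc, e1, e2] with p hp hp1 hp2
  have hpi : (Real.pi : ℂ) ≠ 0 := by exact_mod_cast Real.pi_ne_zero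
  have hKint : Integrable (fun q => diskKernel p.1 q.1 * (diskKernel p.2 q.2 * G q))
      bidiscMeasure := by
    refine Integrable.bdd_mul (c := ((1 - ‖p.1‖) ^ 2)⁻¹) (Integrable.bdd_mul
      (c := ((1 - ‖p.2‖) ^ 2)⁻¹) hG1
      (measurable_diskKernel_comp measurable_const measurable_snd).aestronglyMeasurable ?_)
      (measurable_diskKernel_comp measurable_const measurable_fst).aestronglyMeasurable ?_
    · filter_upwards [ae_bidisc] with q hq using norm_diskKernel_le hp.2.1 hq.2.1.le
    · filter_upwards [ae_bidisc] with q hq using norm_diskKernel_le hp.1 hq.1.le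
  have hKm : AEStronglyMeasurable (fun w => hartogsKernel (hartogsMap p) w * g w)
      (volume.restrict hartogsTriangle) :=
    (measurable_hartogsKernel_comp measurable_const measurable_id).aestronglyMeasurable.mul hgm
  rw [kernelOperator, integral_hartogsTriangle hKm]
  calc _ = ∫ q, (((Real.pi : ℂ) ^ 2)⁻¹ * p.2⁻¹) *
        (diskKernel p.1 q.1 * (diskKernel p.2 q.2 * G q)) ∂bidiscMeasure := by
        refine integral_congr_ae ?_
        filter_upwards [ae_bidisc] with q hq
        have hq2 : q.2 ≠ 0 := hq.2.2
        have hqc : conj q.2 ≠ 0 := by simpa using hq2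
        have : ((‖q.2‖ ^ 2 : ℝ) : ℂ) = q.2 * conj q.2 := by
          rw [Complex.mul_conj, Complex.normSq_eq_norm_sq]
        rw [hartogsKernel_hartogsMap hp.2.2 hq2, Complex.real_smul, this, mul_inv]
        simp only [hG]
        have hp2' := hp.2.2
        field_simp
    _ = (((Real.pi : ℂ) ^ 2)⁻¹ * p.2⁻¹) *
        ∫ s, ∫ t, diskKernel p.1 s * (diskKernel p.2 t * G (s, t)) ∂D ∂D := by
        rw [integral_const_mul, hbi, integral_prod _ (by rw [← hbi]; exact hKint)]
    _ = (((Real.pi : ℂ) ^ 2)⁻¹ * p.2⁻¹) *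
        ∫ s, Real.pi * (diskKernel p.1 s * G (s, p.2)) ∂D := by
        congr 1
        refine integral_congr_ae ?_
        filter_upwards [hit, hDlt] with s hs hs1
        rw [integral_const_mul, integral_diskKernel_mul (hdt s hs1) hs hp.2.2 hp.2.1]
        ring
    _ = (((Real.pi : ℂ) ^ 2)⁻¹ * p.2⁻¹) * (Real.pi * (Real.pi * G (p.1, p.2))) := by
        rw [integral_const_mul, integral_diskKernel_mul (hds p.2 hp.2.1 hp.2.2) hp2 hp1 hp.1]
    _ = _ := by
        simp only [hG]
        have hp2' := hp.2.2
        field_simp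

/-! ### Holomorphy of the operator's values. -/

/-- The derivative in the first variable of `hartogsKernel`. -/
noncomputable def hartogsKernelFDeriv (z w : ℂ × ℂ) : ℂ × ℂ →L[ℂ] ℂ :=
  (((Real.pi : ℂ) ^ 2)⁻¹ * (conj w.2)⁻¹) •
    ((((z.2 - z.1 * conj (w.1 / w.2)) ^ 2)⁻¹ * ((1 - z.2 * conj w.2) ^ 2)⁻¹
      - 2 * z.2 * ((z.2 - z.1 * conj (w.1 / w.2)) ^ 3)⁻¹ * ((1 - z.2 * conj w.2) ^ 2)⁻¹
      + 2 * z.2 * ((z.2 - z.1 * conj (w.1 / w.2)) ^ 2)⁻¹ * ((1 - z.2 * conj w.2) ^ 3)⁻¹ * conj w.2)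
        • ContinuousLinearMap.snd ℂ ℂ ℂ +
    (2 * z.2 * conj (w.1 / w.2) * ((z.2 - z.1 * conj (w.1 / w.2)) ^ 3)⁻¹ *
      ((1 - z.2 * conj w.2) ^ 2)⁻¹) • ContinuousLinearMap.fst ℂ ℂ ℂ)

/-- This form has no quotient by `z.2`: its denominators in `z` are bounded below by `‖z.2‖ - ‖z.1‖`
and `1 - ‖z.2‖`, uniformly in `w`. -/
theorem hartogsKernel_eq {z : ℂ × ℂ} (hz : z.2 ≠ 0) (w : ℂ × ℂ) :
    hartogsKernel z w = (((Real.pi : ℂ) ^ 2)⁻¹ * (conj w.2)⁻¹) *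
      (z.2 * (((z.2 - z.1 * conj (w.1 / w.2)) ^ 2)⁻¹ * ((1 - z.2 * conj w.2) ^ 2)⁻¹)) := by
  have : 1 - z.1 / z.2 * conj (w.1 / w.2) = (z.2 - z.1 * conj (w.1 / w.2)) / z.2 := by
    field_simp
  rw [hartogsKernel, diskKernel, diskKernel, this, div_pow, mul_inv, inv_div]
  field_simp

theorem le_norm_snd_sub {z w : ℂ × ℂ} (hw : w ∈ hartogsTriangle) :
    ‖z.2‖ - ‖z.1‖ ≤ ‖z.2 - z.1 * conj (w.1 / w.2)‖ := by
  have h1 : ‖z.1 * conj (w.1 / w.2)‖ ≤ ‖z.1‖ := by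
    rw [norm_mul, RCLike.norm_conj]
    exact mul_le_of_le_one_right (norm_nonneg _) (norm_div_lt_one_of_mem_hartogsTriangle hw).le
  have h2 := norm_sub_norm_le z.2 (z.1 * conj (w.1 / w.2))
  linarith

theorem hasDerivAt_sq_inv {x : ℂ} (hx : x ≠ 0) :
    HasDerivAt (fun x : ℂ => (x ^ 2)⁻¹) (-2 * (x ^ 3)⁻¹) x := by
  have := (hasDerivAt_pow 2 x).fun_inv (pow_ne_zero 2 hx)
  refine this.congr_deriv ?_
  field_simp
  simp [mul_comm]

theorem hasFDerivAt_hartogsKernel {z w : ℂ × ℂ} (hz : z ∈ hartogsTriangle)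
    (hw : w ∈ hartogsTriangle) :
    HasFDerivAt (fun z => hartogsKernel z w) (hartogsKernelFDeriv z w) z := by
  have hz2 := snd_ne_zero_of_mem_hartogsTriangle hz
  have hev : (fun z => (((Real.pi : ℂ) ^ 2)⁻¹ * (conj w.2)⁻¹) *
      (z.2 * (((z.2 - z.1 * conj (w.1 / w.2)) ^ 2)⁻¹ * ((1 - z.2 * conj w.2) ^ 2)⁻¹)))
      =ᶠ[nhds z] fun z => hartogsKernel z w := by
    filter_upwards [isOpen_hartogsTriangle.mem_nhds hz] with y hy
    rw [hartogsKernel_eq (snd_ne_zero_of_mem_hartogsTriangle hy)]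
  refine HasFDerivAt.congr_of_eventuallyEq ?_ hev.symm
  have hA : z.2 - z.1 * conj (w.1 / w.2) ≠ 0 := by
    have := le_norm_snd_sub (z := z) hw
    rw [← norm_pos_iff]
    linarith [hz.1]
  have hB : 1 - z.2 * conj w.2 ≠ 0 := one_sub_mul_conj_ne_zero hz.2 hw.2.le
  have h1 : HasFDerivAt (fun z : ℂ × ℂ => z.1) (ContinuousLinearMap.fst ℂ ℂ ℂ) z := hasFDerivAt_fst
  have h2 : HasFDerivAt (fun z : ℂ × ℂ => z.2) (ContinuousLinearMap.snd ℂ ℂ ℂ) z := hasFDerivAt_snd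
  have hA' := (hasDerivAt_sq_inv hA).comp_hasFDerivAt z (h2.fun_sub (h1.mul_const (conj (w.1 / w.2))))
  have hB' := (hasDerivAt_sq_inv hB).comp_hasFDerivAt z ((h2.mul_const (conj w.2)).const_sub 1)
  have h := (h2.fun_mul (hA'.fun_mul hB')).const_mul (((Real.pi : ℂ) ^ 2)⁻¹ * (conj w.2)⁻¹)
  refine h.congr_fderiv ?_
  refine ContinuousLinearMap.ext fun y => ?_
  simp [hartogsKernelFDeriv]
  ring

/-- Both denominators are at least `δ` in modulus. One term has total order four, and the other
three have order five with a factor `2` each, whence `6`. This is the domination for differentiating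
under the integral. -/
theorem norm_hartogsKernelFDeriv_le {z w : ℂ × ℂ} {δ : ℝ} (hδ : 0 < δ) (hz : ‖z.2‖ ≤ 1 - δ)
    (hz' : δ ≤ ‖z.2‖ - ‖z.1‖) (hw : w ∈ hartogsTriangle) :
    ‖hartogsKernelFDeriv z w‖ ≤ (1 / δ ^ 4 + 6 / δ ^ 5) * ‖w.2‖⁻¹ := by
  set A := z.2 - z.1 * conj (w.1 / w.2) with hA
  set B := 1 - z.2 * conj w.2 with hB
  have hA1 : ‖A‖⁻¹ ≤ δ⁻¹ := inv_anti₀ hδ (hz'.trans (le_norm_snd_sub hw))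
  have hB1 : ‖B‖⁻¹ ≤ δ⁻¹ := inv_anti₀ hδ
    (by linarith [one_sub_norm_le_norm_one_sub_mul_conj (v := z.2) hw.2.le])
  have hz1 : ‖z.2‖ ≤ 1 := by linarith
  have hσ : ‖conj (w.1 / w.2)‖ ≤ 1 := by
    rw [RCLike.norm_conj]
    exact (norm_div_lt_one_of_mem_hartogsTriangle hw).le
  have hτ : ‖conj w.2‖ ≤ 1 := by
    rw [RCLike.norm_conj]
    exact hw.2.le
  have hpi : (Real.pi ^ 2)⁻¹ ≤ 1 := inv_le_one_of_one_le₀ (by nlinarith [Real.pi_gt_three])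
  have t1 : ‖(A ^ 2)⁻¹ * (B ^ 2)⁻¹‖ ≤ 1 / δ ^ 4 := by
    rw [norm_mul, norm_inv, norm_inv, norm_pow, norm_pow, ← inv_pow, ← inv_pow]
    calc _ ≤ δ⁻¹ ^ 2 * δ⁻¹ ^ 2 := by gcongr
      _ = _ := by field_simp
  have t2 : ‖2 * z.2 * (A ^ 3)⁻¹ * (B ^ 2)⁻¹‖ ≤ 2 / δ ^ 5 := by
    rw [norm_mul, norm_mul, norm_mul, norm_inv, norm_inv, norm_pow, norm_pow, ← inv_pow, ← inv_pow,
      Complex.norm_ofNat]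
    calc _ ≤ 2 * 1 * δ⁻¹ ^ 3 * δ⁻¹ ^ 2 := by gcongr
      _ = _ := by field_simp
  have t3 : ‖2 * z.2 * (A ^ 2)⁻¹ * (B ^ 3)⁻¹ * conj w.2‖ ≤ 2 / δ ^ 5 := by
    rw [norm_mul, norm_mul, norm_mul, norm_mul, norm_inv, norm_inv, norm_pow, norm_pow, ← inv_pow,
      ← inv_pow, Complex.norm_ofNat]
    calc _ ≤ 2 * 1 * δ⁻¹ ^ 2 * δ⁻¹ ^ 3 * 1 := by gcongr
      _ = _ := by field_simp
  have t4 : ‖2 * z.2 * conj (w.1 / w.2) * (A ^ 3)⁻¹ * (B ^ 2)⁻¹‖ ≤ 2 / δ ^ 5 := by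
    rw [norm_mul, norm_mul, norm_mul, norm_mul, norm_inv, norm_inv, norm_pow, norm_pow, ← inv_pow,
      ← inv_pow, Complex.norm_ofNat]
    calc _ ≤ 2 * 1 * 1 * δ⁻¹ ^ 3 * δ⁻¹ ^ 2 := by gcongr
      _ = _ := by field_simp
  have t5 : ‖((Real.pi : ℂ) ^ 2)⁻¹ * (conj w.2)⁻¹‖ ≤ ‖w.2‖⁻¹ := by
    rw [norm_mul, norm_inv, norm_inv, norm_pow, RCLike.norm_conj, Complex.norm_real,
      Real.norm_of_nonneg Real.pi_pos.le]
    exact mul_le_of_le_one_left (by positivity) hpi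
  rw [hartogsKernelFDeriv, norm_smul, mul_comm]
  refine mul_le_mul ?_ t5 (norm_nonneg _) (by positivity)
  refine (norm_add_le _ _).trans ?_
  rw [norm_smul, norm_smul]
  have s1 := ContinuousLinearMap.norm_snd_le (𝕜 := ℂ) ℂ ℂ
  have s2 := ContinuousLinearMap.norm_fst_le (𝕜 := ℂ) ℂ ℂ
  have u1 : ‖(A ^ 2)⁻¹ * (B ^ 2)⁻¹ - 2 * z.2 * (A ^ 3)⁻¹ * (B ^ 2)⁻¹ +
      2 * z.2 * (A ^ 2)⁻¹ * (B ^ 3)⁻¹ * conj w.2‖ ≤ 1 / δ ^ 4 + 2 / δ ^ 5 + 2 / δ ^ 5 :=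
    (norm_add_le _ _).trans (add_le_add ((norm_sub_le _ _).trans (add_le_add t1 t2)) t3)
  calc _ ≤ (1 / δ ^ 4 + 2 / δ ^ 5 + 2 / δ ^ 5) * 1 + 2 / δ ^ 5 * 1 :=
        add_le_add (mul_le_mul u1 s1 (norm_nonneg _) (by positivity))
          (mul_le_mul t4 s2 (norm_nonneg _) (by positivity))
    _ = _ := by ring

theorem measurable_hartogsKernelFDeriv (z : ℂ × ℂ) : Measurable (hartogsKernelFDeriv z) := by
  unfold hartogsKernelFDeriv
  have hc : Measurable fun t : ℂ => conj t := Complex.continuous_conj.measurable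
  have hc1 : Measurable fun w : ℂ × ℂ => conj w.2 := hc.comp measurable_snd
  have hc2 : Measurable fun w : ℂ × ℂ => conj (w.1 / w.2) :=
    hc.comp (measurable_fst.div measurable_snd)
  apply Measurable.fun_smul
  · fun_prop
  · apply Measurable.fun_add
    · apply Measurable.smul_const
      fun_prop
    · apply Measurable.smul_const
      fun_prop

theorem differentiableOn_kernelOperator_hartogsKernel {f : ℂ × ℂ → ℂ}
    (hm : AEStronglyMeasurable f (volume.restrict hartogsTriangle))
    (hf : IntegrableOn (fun z => ‖z.2‖⁻¹ * ‖f z‖) hartogsTriangle) :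
    DifferentiableOn ℂ (kernelOperator hartogsTriangle hartogsKernel f) hartogsTriangle := by
  intro z hz
  -- Half of the smaller margin at `z`, so that both margins stay above `δ` in a neighbourhood of
  -- `z`.
  set δ := min (1 - ‖z.2‖) (‖z.2‖ - ‖z.1‖) / 2 with hδd
  have hmin : 0 < min (1 - ‖z.2‖) (‖z.2‖ - ‖z.1‖) := lt_min (by linarith [hz.2]) (by linarith [hz.1])
  have hδ : 0 < δ := by positivity
  have l1 := min_le_left (1 - ‖z.2‖) (‖z.2‖ - ‖z.1‖)
  have l2 := min_le_right (1 - ‖z.2‖) (‖z.2‖ - ‖z.1‖)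
  have hs : {y : ℂ × ℂ | ‖y.2‖ < 1 - δ ∧ δ < ‖y.2‖ - ‖y.1‖} ∈ nhds z := by
    have o1 : IsOpen {y : ℂ × ℂ | ‖y.2‖ < 1 - δ} := isOpen_lt (by fun_prop) (by fun_prop)
    have o2 : IsOpen {y : ℂ × ℂ | δ < ‖y.2‖ - ‖y.1‖} := isOpen_lt (by fun_prop) (by fun_prop)
    refine (o1.inter o2).mem_nhds ⟨?_, ?_⟩
    · show ‖z.2‖ < 1 - δ
      linarith
    · show δ < ‖z.2‖ - ‖z.1‖
      linarith
  have hsub : ∀ y : ℂ × ℂ, ‖y.2‖ < 1 - δ ∧ δ < ‖y.2‖ - ‖y.1‖ → y ∈ hartogsTriangle := fun y hy =>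
    ⟨by linarith [hy.2], by linarith [hy.1]⟩
  have key := hasFDerivAt_integral_of_dominated_of_fderiv_le (𝕜 := ℂ)
    (μ := volume.restrict hartogsTriangle) (F := fun y w => hartogsKernel y w * f w)
    (F' := fun y w => f w • hartogsKernelFDeriv y w) (x₀ := z)
    (bound := fun w => (1 / δ ^ 4 + 6 / δ ^ 5) * (‖w.2‖⁻¹ * ‖f w‖)) hs
    (Filter.Eventually.of_forall fun y => (measurable_hartogsKernel_comp measurable_const
      measurable_id).aestronglyMeasurable.mul hm)
    (integrableOn_hartogsKernel_mul hm hf hz)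
    (hm.smul (measurable_hartogsKernelFDeriv z).aestronglyMeasurable) ?_ (hf.const_mul _) ?_
  · exact key.differentiableAt.differentiableWithinAt
  · filter_upwards [ae_restrict_mem measurableSet_hartogsTriangle] with w hw y hy
    rw [norm_smul, mul_comm, ← mul_assoc]
    exact mul_le_mul_of_nonneg_right
      (norm_hartogsKernelFDeriv_le hδ hy.1.le hy.2.le hw) (norm_nonneg _)
  · filter_upwards [ae_restrict_mem measurableSet_hartogsTriangle] with w hw y hy
    exact (hasFDerivAt_hartogsKernel (hsub y hy) hw).mul_const (f w)

/-! ### Uniqueness of the Bergman kernel and its identification. -/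

theorem kernelOperator_congr_ae {Ω : Set (ℂ × ℂ)} (K : ℂ × ℂ → ℂ × ℂ → ℂ) {f g : ℂ × ℂ → ℂ}
    (h : f =ᵐ[volume.restrict Ω] g) : kernelOperator Ω K f = kernelOperator Ω K g := by
  ext z
  exact integral_congr_ae (h.mono fun w hw => by simp only [hw])

/-- The operators of two Bergman kernels of an open set agree on `L²`, at every point. -/
theorem IsBergmanKernel.eqOn_kernelOperator {Ω : Set (ℂ × ℂ)} (hΩ : IsOpen Ω)
    {K K' : ℂ × ℂ → ℂ × ℂ → ℂ} (hK : IsBergmanKernel Ω K) (hK' : IsBergmanKernel Ω K')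
    (f : Lp ℂ 2 (volume.restrict Ω)) :
    Set.EqOn (kernelOperator Ω K f) (kernelOperator Ω K' f) Ω := by
  obtain ⟨h, ho⟩ := hK.projection f
  obtain ⟨h', ho'⟩ := hK'.projection f
  have m : h.toLp ∈ bergmanSpace Ω := ⟨_, hK.holomorphic f, h.coeFn_toLp⟩
  have m' : h'.toLp ∈ bergmanSpace Ω := ⟨_, hK'.holomorphic f, h'.coeFn_toLp⟩
  have m1 : h.toLp - h'.toLp ∈ bergmanSpace Ω := Submodule.sub_mem _ m m'
  have m2 : h.toLp - h'.toLp ∈ (bergmanSpace Ω)ᗮ := by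
    have := Submodule.sub_mem _ ho' ho
    rwa [sub_sub_sub_cancel_left] at this
  have h0 : h.toLp - h'.toLp = 0 := by
    have := Submodule.inner_right_of_mem_orthogonal m1 m2
    exact inner_self_eq_zero.1 this
  have hae : kernelOperator Ω K f =ᵐ[volume.restrict Ω] kernelOperator Ω K' f :=
    (MemLp.toLp_eq_toLp_iff h h').1 (sub_eq_zero.1 h0)
  exact Measure.eqOn_open_of_ae_eq hae hΩ (hK.holomorphic f).continuousOn
    (hK'.holomorphic f).continuousOn

/-- The Bergman kernel of an open set is unique, up to null sets in the second variable. -/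
theorem IsBergmanKernel.ae_eq {Ω : Set (ℂ × ℂ)} (hΩ : IsOpen Ω)
    {K K' : ℂ × ℂ → ℂ × ℂ → ℂ} (hK : IsBergmanKernel Ω K) (hK' : IsBergmanKernel Ω K')
    {z : ℂ × ℂ} (hz : z ∈ Ω) : K z =ᵐ[volume.restrict Ω] K' z := by
  have hd : MemLp (fun w => K z w - K' z w) 2 (volume.restrict Ω) := (hK.memLp z hz).sub (hK'.memLp z hz)
  have hc : MemLp (fun w => conj (K z w - K' z w)) 2 (volume.restrict Ω) := hd.star
  -- Testing the two operators at `z` on the conjugate of `K z - K' z` yields `∫ ‖K z - K' z‖ ^ 2 =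
  -- 0`.
  have h := hK.eqOn_kernelOperator hΩ hK' hc.toLp hz
  rw [kernelOperator_congr_ae K hc.coeFn_toLp, kernelOperator_congr_ae K' hc.coeFn_toLp] at h
  simp only [kernelOperator] at h
  have i1 : Integrable (fun w => K z w * conj (K z w - K' z w)) (volume.restrict Ω) :=
    (hK.memLp z hz).integrable_mul hc
  have i2 : Integrable (fun w => K' z w * conj (K z w - K' z w)) (volume.restrict Ω) :=
    (hK'.memLp z hz).integrable_mul hc
  have h1 : ∫ w in Ω, ((‖K z w - K' z w‖ ^ 2 : ℝ) : ℂ) = 0 := by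
    rw [← sub_eq_zero, ← integral_sub i1 i2] at h
    rw [← h]
    refine integral_congr_ae (Filter.Eventually.of_forall fun w => ?_)
    simp only [← sub_mul, Complex.mul_conj, Complex.normSq_eq_norm_sq]
  rw [integral_complex_ofReal] at h1
  have h2 : ∫ w in Ω, ‖K z w - K' z w‖ ^ 2 = 0 := by exact_mod_cast h1
  rw [integral_eq_zero_iff_of_nonneg (fun w => by positivity)
    ((memLp_two_iff_integrable_sq_norm hd.1).1 hd)] at h2
  filter_upwards [h2] with w hw
  have : ‖K z w - K' z w‖ ^ 2 = 0 := hw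
  simpa [sub_eq_zero] using this

theorem hartogsMeasure_neg_zero : hartogsMeasure (-0) = volume.restrict hartogsTriangle := by
  rw [neg_zero, hartogsMeasure_zero]

theorem integrable_norm_inv_mul_of_memLp_two {f : ℂ × ℂ → ℂ}
    (hf : MemLp f 2 (volume.restrict hartogsTriangle)) :
    IntegrableOn (fun z => ‖z.2‖⁻¹ * ‖f z‖) hartogsTriangle :=
  integrable_norm_inv_mul_of_memLp (P := 2) (ε := 0) (by simp) (by simp) (by norm_num)
    (by rwa [hartogsMeasure_neg_zero])

theorem memLp_two_kernelOperator_hartogsKernel {f : ℂ × ℂ → ℂ}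
    (hf : MemLp f 2 (volume.restrict hartogsTriangle)) :
    MemLp (kernelOperator hartogsTriangle hartogsKernel f) 2 (volume.restrict hartogsTriangle) := by
  obtain ⟨C, hC⟩ := exists_eLpNorm_kernelOperator_le (P := 2) (ε := 0) (by simp) (by simp)
    (by norm_num) (by norm_num) (by norm_num)
  rw [hartogsMeasure_neg_zero] at hC
  exact ⟨aestronglyMeasurable_kernelOperator hf.1,
    (hC f hf.1).trans_lt (ENNReal.mul_lt_top (by simp) hf.2)⟩

/-- The Fubini hypothesis for the adjoint computation: the operator with kernel `|hartogsKernel|` is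
bounded on `L²`, and Cauchy-Schwarz pairs its value with `g`. -/
theorem integrable_conj_mul_hartogsKernel_mul {f g : ℂ × ℂ → ℂ}
    (hf : MemLp f 2 (volume.restrict hartogsTriangle))
    (hg : MemLp g 2 (volume.restrict hartogsTriangle)) :
    Integrable (fun x : (ℂ × ℂ) × (ℂ × ℂ) => conj (g x.1) * (hartogsKernel x.1 x.2 * f x.2))
      ((volume.restrict hartogsTriangle).prod (volume.restrict hartogsTriangle)) := by
  set μ := volume.restrict hartogsTriangle
  have hm : AEStronglyMeasurable (fun x : (ℂ × ℂ) × (ℂ × ℂ) =>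
      conj (g x.1) * (hartogsKernel x.1 x.2 * f x.2)) (μ.prod μ) :=
    (Complex.continuous_conj.comp_aestronglyMeasurable hg.1.comp_fst).mul
      ((measurable_hartogsKernel_comp measurable_fst measurable_snd).aestronglyMeasurable.mul
        hf.1.comp_snd)
  refine ⟨hm, ?_⟩
  obtain ⟨C, hC⟩ := exists_lintegral_hartogs_rpow_le (p := 2) (ε := 0) (by norm_num)
    (by norm_num) (by norm_num) (by norm_num)
  have h1 := hC (fun w => ‖f w‖ₑ) hf.1.enorm
  simp only [neg_zero, Real.rpow_zero, ENNReal.ofReal_one, mul_one] at h1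
  have hff : ∫⁻ z, ‖f z‖ₑ ^ (2 : ℝ) ∂μ < ∞ := by
    have := lintegral_rpow_enorm_lt_top_of_eLpNorm_lt_top two_ne_zero (by simp) hf.2
    simpa using this
  have hgg : ∫⁻ z, ‖g z‖ₑ ^ (2 : ℝ) ∂μ < ∞ := by
    have := lintegral_rpow_enorm_lt_top_of_eLpNorm_lt_top two_ne_zero (by simp) hg.2
    simpa using this
  have hT : AEMeasurable (fun z => ∫⁻ w, ‖hartogsKernel z w‖ₑ * ‖f w‖ₑ ∂μ) μ := by
    have : AEMeasurable (fun x : (ℂ × ℂ) × (ℂ × ℂ) => ‖hartogsKernel x.1 x.2‖ₑ * ‖f x.2‖ₑ)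
        (μ.prod μ) :=
      (measurable_hartogsKernel_comp measurable_fst measurable_snd).enorm.aemeasurable.mul
        hf.1.comp_snd.enorm
    exact this.lintegral_prod_right'
  have hH := ENNReal.lintegral_mul_le_Lp_mul_Lq μ (p := 2) (q := 2)
    (by constructor <;> norm_num) hg.1.enorm hT
  rw [HasFiniteIntegral, lintegral_prod _ hm.enorm]
  refine lt_of_le_of_lt (le_trans (le_of_eq ?_) hH) ?_
  · refine lintegral_congr fun z => ?_
    simp only [enorm_mul, Pi.mul_apply, RCLike.enorm_conj]
    rw [lintegral_const_mul' _ _ enorm_ne_top]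
  · exact ENNReal.mul_lt_top (ENNReal.rpow_lt_top_of_nonneg (by norm_num) hgg.ne)
      (ENNReal.rpow_lt_top_of_nonneg (by norm_num)
        (h1.trans_lt (ENNReal.mul_lt_top (by simp) hff)).ne)

/-- By Hermitian symmetry of the kernel the operator can be moved onto `g`, which it reproduces.
This says that `f` minus its image is orthogonal to `A²`. -/
theorem integral_conj_mul_kernelOperator_hartogsKernel {f g : ℂ × ℂ → ℂ}
    (hf : MemLp f 2 (volume.restrict hartogsTriangle))
    (hg : MemLp g 2 (volume.restrict hartogsTriangle))
    (hd : DifferentiableOn ℂ g hartogsTriangle) :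
    ∫ z in hartogsTriangle, conj (g z) * kernelOperator hartogsTriangle hartogsKernel f z =
      ∫ z in hartogsTriangle, conj (g z) * f z := by
  have hrep := ae_kernelOperator_hartogsKernel_eq hd ((memLp_two_iff_integrable_sq_norm hg.1).1 hg)
  calc _ = ∫ z in hartogsTriangle, ∫ w in hartogsTriangle,
        conj (g z) * (hartogsKernel z w * f w) := by
        simp only [kernelOperator, integral_const_mul]
    _ = ∫ w in hartogsTriangle, ∫ z in hartogsTriangle,
        conj (g z) * (hartogsKernel z w * f w) :=
        integral_integral_swap (integrable_conj_mul_hartogsKernel_mul hf hg)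
    _ = ∫ w in hartogsTriangle, conj (kernelOperator hartogsTriangle hartogsKernel g w) * f w := by
        refine integral_congr_ae (Filter.Eventually.of_forall fun w => ?_)
        simp only [kernelOperator]
        rw [← integral_conj, ← integral_mul_const]
        refine integral_congr_ae (Filter.Eventually.of_forall fun z => ?_)
        simp only [map_mul, conj_hartogsKernel]
        ring
    _ = _ := integral_congr_ae (hrep.mono fun w hw => by simp only [hw])

theorem isBergmanKernel_hartogsKernel : IsBergmanKernel hartogsTriangle hartogsKernel where
  memLp _ hz := memLp_hartogsKernel hz
  antiholomorphic z hz w hw := by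
    simp only [conj_hartogsKernel]
    exact (hasFDerivAt_hartogsKernel hw hz).differentiableAt.differentiableWithinAt
  holomorphic f := differentiableOn_kernelOperator_hartogsKernel (Lp.memLp f).1
    (integrable_norm_inv_mul_of_memLp_two (Lp.memLp f))
  projection f := by
    have h := memLp_two_kernelOperator_hartogsKernel (Lp.memLp f)
    refine ⟨h, (Submodule.mem_orthogonal _ _).2 ?_⟩
    rintro u ⟨g, hd, hug⟩
    have hg : MemLp g 2 (volume.restrict hartogsTriangle) := (memLp_congr_ae hug).1 (Lp.memLp u)
    rw [inner_sub_right, sub_eq_zero, L2.inner_def, L2.inner_def]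
    have h1 : ∫ z in hartogsTriangle, inner ℂ (u z) (f z) =
        ∫ z in hartogsTriangle, conj (g z) * f z :=
      integral_congr_ae (hug.mono fun z hz => by simp only [hz, RCLike.inner_apply, mul_comm])
    have h2 : ∫ z in hartogsTriangle, inner ℂ (u z) ((h.toLp : Lp ℂ 2 (volume.restrict hartogsTriangle)) z) =
        ∫ z in hartogsTriangle, conj (g z) * kernelOperator hartogsTriangle hartogsKernel f z := by
      refine integral_congr_ae ?_
      filter_upwards [hug, h.coeFn_toLp] with z hz hz'
      rw [hz, hz', RCLike.inner_apply, mul_comm]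
    rw [h1, h2, integral_conj_mul_kernelOperator_hartogsKernel (Lp.memLp f) hg hd]

theorem isBergmanKernel_bergmanKernel_hartogsTriangle :
    IsBergmanKernel hartogsTriangle (bergmanKernel hartogsTriangle) := by
  have h : ∃ K, IsBergmanKernel hartogsTriangle K := ⟨_, isBergmanKernel_hartogsKernel⟩
  rw [bergmanKernel, dif_pos h]
  exact h.choose_spec

theorem bergmanKernel_hartogsTriangle_ae_eq {z : ℂ × ℂ} (hz : z ∈ hartogsTriangle) :
    bergmanKernel hartogsTriangle z =ᵐ[volume.restrict hartogsTriangle] hartogsKernel z :=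
  isBergmanKernel_bergmanKernel_hartogsTriangle.ae_eq isOpen_hartogsTriangle
    isBergmanKernel_hartogsKernel hz

theorem bergmanProjection_hartogsTriangle_ae_eq (f : ℂ × ℂ → ℂ) :
    bergmanProjection hartogsTriangle f =ᵐ[volume.restrict hartogsTriangle]
      kernelOperator hartogsTriangle hartogsKernel f := by
  filter_upwards [ae_restrict_mem measurableSet_hartogsTriangle] with z hz
  exact integral_congr_ae ((bergmanKernel_hartogsTriangle_ae_eq hz).mono fun w hw => by
    simp only [hw])

theorem integrableOn_bergmanKernel_mul {P : ℝ≥0∞} {ε : ℝ} (hPt : P ≠ ∞) (hp : 1 < P.toReal)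
    (h1 : 4 - 3 * P.toReal < ε) {f : ℂ × ℂ → ℂ} (hf : MemLp f P (hartogsMeasure (-ε)))
    {z : ℂ × ℂ} (hz : z ∈ hartogsTriangle) :
    IntegrableOn (fun w => bergmanKernel hartogsTriangle z w * f w) hartogsTriangle := by
  have hm := hf.1.mono_ac (absolutelyContinuous_hartogsMeasure _)
  refine (integrableOn_hartogsKernel_mul hm
    (integrable_norm_inv_mul_of_memLp hPt hp h1 hf) hz).congr ?_
  filter_upwards [bergmanKernel_hartogsTriangle_ae_eq hz] with w hw
  rw [hw]

/-! ### The strong and weak bounds for the Bergman projection. -/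

/-- The strong-type bound for the Bergman projection of the Hartogs triangle. -/
theorem exists_eLpNorm_bergmanProjection_le {P : ℝ≥0∞} {ε : ℝ} (hPt : P ≠ ∞) (hp : 1 < P.toReal)
    (hp3 : P.toReal < 3) (h1 : 4 - 3 * P.toReal < ε) (h2 : ε < 4 - P.toReal) :
    ∃ C : ℝ≥0, ∀ f : ℂ × ℂ → ℂ, MemLp f P (hartogsMeasure (-ε)) →
      MemLp (bergmanProjection hartogsTriangle f) P (hartogsMeasure (-ε)) ∧
      eLpNorm (bergmanProjection hartogsTriangle f) P (hartogsMeasure (-ε)) ≤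
        C * eLpNorm f P (hartogsMeasure (-ε)) := by
  obtain ⟨C, hC⟩ := exists_eLpNorm_kernelOperator_le hPt hp hp3 h1 h2
  refine ⟨C, fun f hf => ?_⟩
  have hm := hf.1.mono_ac (absolutelyContinuous_hartogsMeasure _)
  have hae := (hartogsMeasure_absolutelyContinuous (-ε)).ae_eq
    (bergmanProjection_hartogsTriangle_ae_eq f)
  have hle := hC f hm
  rw [← eLpNorm_congr_ae hae] at hle
  refine ⟨⟨?_, hle.trans_lt (ENNReal.mul_lt_top (by simp) hf.2)⟩, hle⟩
  exact ((aestronglyMeasurable_kernelOperator hm).mono_ac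
    (hartogsMeasure_absolutelyContinuous _)).congr hae.symm

theorem hartogsMeasure_mono {a b : ℝ} (hab : a ≤ b) : hartogsMeasure b ≤ hartogsMeasure a := by
  refine withDensity_mono ?_
  filter_upwards [ae_restrict_mem measurableSet_hartogsTriangle] with z hz
  have := norm_pos_iff.2 (snd_ne_zero_of_mem_hartogsTriangle hz)
  exact ENNReal.ofReal_le_ofReal (Real.rpow_le_rpow_of_exponent_ge this hz.2.le hab)

theorem theorem4p6 :
    IsBergmanKernel hartogsTriangle (bergmanKernel hartogsTriangle) ∧
    (∀ ε : ℝ, 0 < ε → ∃ C : ℝ≥0, ∀ f : ℂ × ℂ → ℂ, MemLp f (4 / 3) (hartogsMeasure (-ε)) →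
      (∀ z ∈ hartogsTriangle,
        IntegrableOn (fun w => bergmanKernel hartogsTriangle z w * f w) hartogsTriangle) ∧
      AEStronglyMeasurable (bergmanProjection hartogsTriangle f)
        (volume.restrict hartogsTriangle) ∧
      ∀ t : ℝ, 0 < t →
        volume {z ∈ hartogsTriangle | t < ‖bergmanProjection hartogsTriangle f z‖} ≤
          C * eLpNorm f (4 / 3) (hartogsMeasure (-ε)) ^ (4 / 3 : ℝ) /
            ENNReal.ofReal t ^ (4 / 3 : ℝ)) ∧
    (∀ ε : ℝ, 0 < ε → ε < 8 / 3 → ∃ C : ℝ≥0, ∀ f : ℂ × ℂ → ℂ,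
      MemLp f (4 / 3) (hartogsMeasure (-ε)) →
        MemLp (bergmanProjection hartogsTriangle f) (4 / 3) (hartogsMeasure (-ε)) ∧
        eLpNorm (bergmanProjection hartogsTriangle f) (4 / 3) (hartogsMeasure (-ε)) ≤
          C * eLpNorm f (4 / 3) (hartogsMeasure (-ε))) := by
  have hPr : (4 / 3 : ℝ≥0∞).toReal = 4 / 3 := by simp [ENNReal.toReal_div]
  have hPt : (4 / 3 : ℝ≥0∞) ≠ ∞ := ENNReal.div_ne_top (by simp) (by simp)
  have hP0 : (4 / 3 : ℝ≥0∞) ≠ 0 := by simp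
  have strong : ∀ ε : ℝ, 0 < ε → ε < 8 / 3 → ∃ C : ℝ≥0, ∀ f : ℂ × ℂ → ℂ,
      MemLp f (4 / 3) (hartogsMeasure (-ε)) →
        MemLp (bergmanProjection hartogsTriangle f) (4 / 3) (hartogsMeasure (-ε)) ∧
        eLpNorm (bergmanProjection hartogsTriangle f) (4 / 3) (hartogsMeasure (-ε)) ≤
          C * eLpNorm f (4 / 3) (hartogsMeasure (-ε)) := fun ε h0 h1 =>
    exists_eLpNorm_bergmanProjection_le hPt (by rw [hPr]; norm_num) (by rw [hPr]; norm_num)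
      (by rw [hPr]; linarith) (by rw [hPr]; linarith)
  refine ⟨isBergmanKernel_bergmanKernel_hartogsTriangle, fun ε hε => ?_, strong⟩
  -- The weak bound is claimed for every `ε > 0`, the strong one only below `8/3`. The exponent `min
  -- ε 1` is admissible, and its weight lies between `1` and `‖z.2‖ ^ (-ε)`.
  obtain ⟨C, hC⟩ := strong (min ε 1) (lt_min hε one_pos) ((min_le_right _ _).trans_lt (by norm_num))
  have hμ : hartogsMeasure (-(min ε 1)) ≤ hartogsMeasure (-ε) :=
    hartogsMeasure_mono (neg_le_neg (min_le_left _ _))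
  have hμ0 : volume.restrict hartogsTriangle ≤ hartogsMeasure (-(min ε 1)) := by
    rw [← hartogsMeasure_zero]
    exact hartogsMeasure_mono (neg_nonpos.2 (le_min hε.le zero_le_one))
  refine ⟨C ^ (4 / 3 : ℝ), fun f hf => ?_⟩
  have hle := (hC f (hf.mono_measure hμ)).2
  have hm : AEStronglyMeasurable (bergmanProjection hartogsTriangle f)
      (volume.restrict hartogsTriangle) :=
    (aestronglyMeasurable_kernelOperator
      (hf.1.mono_ac (absolutelyContinuous_hartogsMeasure _))).congr
      (bergmanProjection_hartogsTriangle_ae_eq f).symm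
  refine ⟨fun z hz => integrableOn_bergmanKernel_mul hPt (by rw [hPr]; norm_num)
    (by rw [hPr]; linarith) hf hz, hm, fun t ht => ?_⟩
  -- Chebyshev's inequality for the unweighted measure.
  have hch := mul_meas_ge_le_pow_eLpNorm' _ hP0 hPt hm (ENNReal.ofReal t)
  rw [hPr] at hch
  rw [ENNReal.le_div_iff_mul_le (Or.inl (by simp [ht.not_ge]))
    (Or.inl (by finiteness)), mul_comm]
  calc _ ≤ ENNReal.ofReal t ^ (4 / 3 : ℝ) * (volume.restrict hartogsTriangle)
        {z | ENNReal.ofReal t ≤ ‖bergmanProjection hartogsTriangle f z‖ₑ} := by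
        rw [Measure.restrict_apply' measurableSet_hartogsTriangle]
        gcongr
        rintro z ⟨hz, hzt⟩
        refine ⟨?_, hz⟩
        show ENNReal.ofReal t ≤ ‖bergmanProjection hartogsTriangle f z‖ₑ
        rw [← ofReal_norm]
        exact ENNReal.ofReal_le_ofReal hzt.le
    _ ≤ eLpNorm (bergmanProjection hartogsTriangle f) (4 / 3)
        (volume.restrict hartogsTriangle) ^ (4 / 3 : ℝ) := hch
    _ ≤ (C * eLpNorm f (4 / 3) (hartogsMeasure (-ε))) ^ (4 / 3 : ℝ) := by
        refine ENNReal.rpow_le_rpow ?_ (by norm_num)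
        exact (eLpNorm_mono_measure _ hμ0).trans (hle.trans (by
          gcongr))
    _ = _ := by
        rw [ENNReal.mul_rpow_of_nonneg _ _ (by norm_num), ENNReal.coe_rpow_of_nonneg _ (by norm_num)]
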